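/- **Theorem 4.6.** Let $R$ be a commutative noetherian local ring of Krull dimension $d$ with maximal ideal $\mathfrak m$. Let $\operatorname{mod}R$ be the category of finitely generated $R$-modules, $\mathrm D^{\mathrm b}(R)$ its bounded derived category, and $\mathrm D_{\mathrm{sg}}(R)$ the singularity category, i.e. the Verdier quotient of $\mathrm D^{\mathrm b}(R)$ by the perfect complexes (the objects isomorphic to bounded complexes of finitely generated projective modules). All subcategories are full. For a subcategory $\mathcal C$ of an abelian category $\mathcal A$ with enough projectives, let $[\mathcal C]$ be the smallest subcategory of $\mathcal A$ that contains $\mathcal C$ and the projective objects and is closed under finite direct sums, direct summands and syzygies. Put $[\mathcal C]_1=[\mathcal C]$ and, for $r\ge 2$, $[\mathcal C]_r=\big[[\mathcal C]_{r-1}\circ[\mathcal C]\big]$, where $\mathcal X\circ\mathcal Y$ consists of the objects $M$ that fit into an exact sequence $0\to X\to M\to Y\to 0$ with $X\in\mathcal X$, $Y\in\mathcal Y$. For a subcategory $\mathcal C$ of a triangulated category $\mathcal T$, let $\langle\mathcal C\rangle$ be the smallest subcategory of $\mathcal T$ that contains $\mathcal C$ and is closed under finite direct sums, direct summands and shifts.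 Put $\langle\mathcal C\rangle_1=\langle\mathcal C\rangle$ and, for $r\ge 2$, $\langle\mathcal C\rangle_r=\big\langle\langle\mathcal C\rangle_{r-1}\ast\langle\mathcal C\rangle\big\rangle$, where $\mathcal X\ast\mathcal Y$ consists of the objects $M$ that fit into an exact triangle $X\to M\to Y\rightsquigarrow$ with $X\in\mathcal X$, $Y\in\mathcal Y$. Let $\operatorname{mod}^{\{\mathfrak m\}}(R)$ be the subcategory of those $M\in\operatorname{mod}R$ such that $M_{\mathfrak p}$ is a free $R_{\mathfrak p}$-module for all prime ideals $\mathfrak p\neq\mathfrak m$, let $\mathrm D_{\mathrm{sg}}^{\{\mathfrak m\}}(R)$ be the subcategory of those $X\in\mathrm D_{\mathrm{sg}}(R)$ such that $X_{\mathfrak p}\cong 0$ in $\mathrm D_{\mathrm{sg}}(R_{\mathfrak p})$ for all prime ideals $\mathfrak p\neq\mathfrak m$, and let $\mathrm{fl}(R)$ be the subcategory of $\operatorname{mod}R$ of modules of finite length, identified with its image in $\mathrm D_{\mathrm{sg}}(R)$ where appropriate. Then $$\operatorname{mod}^{\{\mathfrak m\}}(R)=[\mathrm{fl}(R)]_{d+1}\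 \text{ in } \operatorname{mod}R,\qquad \mathrm D_{\mathrm{sg}}^{\{\mathfrak m\}}(R)=\langle\mathrm{fl}(R)\rangle_{d+1}\ \text{ in } \mathrm D_{\mathrm{sg}}(R).$$ -/

import Mathlib

open CategoryTheory CategoryTheory.Limits CategoryTheory.Pretriangulated

universe v u

/-! ### Balls in an abelian category -/

section AbelianBalls

variable {A : Type u} [Category.{v} A] [Abelian A]

/-- `[P]`: the smallest subcategory of `A` that contains the projective objects and `P` and is
closed under finite direct sums, direct summands and syzygies.  (The zero object is projective.) -/
inductive abBracket (P : ObjectProperty A) : ObjectProperty A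
  | of_mem (X : A) : P X → abBracket P X
  | of_projective (X : A) : Projective X → abBracket P X
  | biprod (X Y : A) : abBracket P X → abBracket P Y → abBracket P (X ⊞ Y)
  | retract {X Y : A} : Retract X Y → abBracket P Y → abBracket P X
  | syzygy (S : ShortComplex A) : S.ShortExact → Projective S.X₂ →
      abBracket P S.X₃ → abBracket P S.X₁

/-- `P ∘ Q`: the middle terms `M` of short exact sequences `0 → X → M → Y → 0` with `X` in `P`
and `Y` in `Q`. -/
def abExtension (P Q : ObjectProperty A) : ObjectProperty A := fun M =>
  ∃ (X Y : A) (f : X ⟶ M) (g : M ⟶ Y) (w : f ≫ g = 0),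
    (ShortComplex.mk f g w).ShortExact ∧ P X ∧ Q Y

/-- `P • Q = [[P] ∘ [Q]]`. -/
def abBullet (P Q : ObjectProperty A) : ObjectProperty A :=
  abBracket (abExtension (abBracket P) (abBracket Q))

/-- The ball `[C]_r` of radius `r ≥ 1` centered at `C` (the value at `r = 0` is a dummy value):
`[C]_1 = [C]` and `[C]_r = [C]_{r-1} • C` for `r ≥ 2`. -/
def abBall (C : ObjectProperty A) : ℕ → ObjectProperty A
  | 0 => ⊥
  | 1 => abBracket C
  | n + 2 => abBullet (abBall C (n + 1)) C

end AbelianBalls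

/-! ### Balls in a triangulated category -/

section TriangulatedBalls

variable {T : Type u} [Category.{v} T] [HasZeroObject T] [HasShift T ℤ] [Preadditive T]
  [∀ n : ℤ, (shiftFunctor T n).Additive] [Pretriangulated T]

/-- `⟨P⟩`: the smallest subcategory of `T` that contains `P` and is closed under finite direct sums
(including the empty one), direct summands and shifts. -/
inductive triBracket (P : ObjectProperty T) : ObjectProperty T
  | of_mem (X : T) : P X → triBracket P X
  | zero (X : T) : IsZero X → triBracket P X
  | biprod (X Y : T) : triBracket P X → triBracket P Y → triBracket P (X ⊞ Y)
  | retract {X Y : T} : Retract X Y → triBracket P Y → triBracket P X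
  | shift (X : T) (n : ℤ) : triBracket P X → triBracket P (X⟦n⟧)

/-- `P ⋄ Q = ⟨⟨P⟩ ∗ ⟨Q⟩⟩`, where `X ∗ Y` consists of the objects `M` that fit into an exact
triangle `X → M → Y ⇝` (this is `ObjectProperty.extensionProduct`). -/
def triDiamond (P Q : ObjectProperty T) : ObjectProperty T :=
  triBracket (ObjectProperty.extensionProduct (triBracket P) (triBracket Q))

/-- The ball `⟨C⟩_r` of radius `r ≥ 1` centered at `C` (the value at `r = 0` is a dummy value):
`⟨C⟩_1 = ⟨C⟩` and `⟨C⟩_r = ⟨C⟩_{r-1} ⋄ C` for `r ≥ 2`. -/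
def triBall (C : ObjectProperty T) : ℕ → ObjectProperty T
  | 0 => ⊥
  | 1 => triBracket C
  | n + 2 => triDiamond (triBall C (n + 1)) C

end TriangulatedBalls

/-! ### The bounded derived category and the singularity category of a noetherian ring -/

section Singularity

open scoped ZeroObject

variable (R : Type u) [CommRing R] [IsNoetherianRing R]

noncomputable instance fgHasDerivedCategory :
    HasDerivedCategory.{u + 1} (FGModuleCat.{u} R) :=
  HasDerivedCategory.standard _

/-- The bounded derived category of the category of finitely generated `R`-modules. -/
abbrev Db : Type (u + 1) := DerivedCategory.Bounded (FGModuleCat.{u} R)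


variable {R} in
theorem projective_of_moduleProjective (M : FGModuleCat.{u} R) (h : Module.Projective R M) :
    Projective M where
  factors {E X} f e he := by
    have he' : Function.Surjective e.hom.hom := by
      have : Epi ((forget₂ (FGModuleCat R) (ModuleCat R)).map e) := inferInstance
      exact (ModuleCat.epi_iff_surjective _).1 this
    obtain ⟨g, hg⟩ := Module.projective_lifting_property e.hom.hom f.hom.hom he'
    exact ⟨ObjectProperty.homMk (ModuleCat.ofHom g), by ext x; exact LinearMap.congr_fun hg x⟩

/-- A perfect complex, as an object of the derived category of finitely generated `R`-modules, is
an object isomorphic to a bounded complex of finitely generated projective `R`-modules. -/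
def perfectObj : ObjectProperty (DerivedCategory (FGModuleCat.{u} R)) := fun X =>
  ∃ (K : CochainComplex (FGModuleCat.{u} R) ℤ) (a b : ℤ),
    K.IsStrictlyGE a ∧ K.IsStrictlyLE b ∧ (∀ i : ℤ, Module.Projective R (K.X i)) ∧
      Nonempty (X ≅ DerivedCategory.Q.obj K)

instance perfectObj_isClosedUnderIsomorphisms : (perfectObj R).IsClosedUnderIsomorphisms where
  of_iso e := by
    rintro ⟨K, a, b, ha, hb, hK, ⟨e'⟩⟩
    exact ⟨K, a, b, ha, hb, hK, ⟨e.symm ≪≫ e'⟩⟩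

instance perfectObj_containsZero : (perfectObj R).ContainsZero where
  exists_zero := by
    refine ⟨DerivedCategory.Q.obj 0, DerivedCategory.Q.map_isZero (isZero_zero _), 0, 0, 0,
      ?_, ?_, ?_, ⟨Iso.refl _⟩⟩
    · rw [CochainComplex.isStrictlyGE_iff]
      intro i _
      exact (HomologicalComplex.eval _ _ i).map_isZero (isZero_zero _)
    · rw [CochainComplex.isStrictlyLE_iff]
      intro i _
      exact (HomologicalComplex.eval _ _ i).map_isZero (isZero_zero _)
    · intro i
      have h : IsZero ((0 : CochainComplex (FGModuleCat.{u} R) ℤ).X i) :=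
        (HomologicalComplex.eval _ _ i).map_isZero (isZero_zero _)
      have h' := (forget₂ (FGModuleCat R) (ModuleCat R)).map_isZero h
      have : Subsingleton ((0 : CochainComplex (FGModuleCat.{u} R) ℤ).X i) :=
        ModuleCat.subsingleton_of_isZero h'
      infer_instance

instance perfectObj_isStableUnderShift : (perfectObj R).IsStableUnderShift ℤ where
  isStableUnderShiftBy n := ObjectProperty.IsStableUnderShiftBy.mk <| by
    rintro X ⟨K, a, b, ha, hb, hK, ⟨e⟩⟩
    exact ⟨K⟦n⟧, a - n, b - n, K.isStrictlyGE_shift a n (a - n) (by lia),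
      K.isStrictlyLE_shift b n (b - n) (by lia), fun i => hK (i + n),
      ⟨(shiftFunctor _ n).mapIso e ≪≫ (DerivedCategory.Q.commShiftIso n).symm.app K⟩⟩

theorem perfectObj_mappingCone {K L : CochainComplex (FGModuleCat.{u} R) ℤ} (f : K ⟶ L)
    (hK : ∃ a b : ℤ, K.IsStrictlyGE a ∧ K.IsStrictlyLE b ∧ ∀ i : ℤ, Module.Projective R (K.X i))
    (hL : ∃ a b : ℤ, L.IsStrictlyGE a ∧ L.IsStrictlyLE b ∧ ∀ i : ℤ, Module.Projective R (L.X i)) :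
    perfectObj R (DerivedCategory.Q.obj (CochainComplex.mappingCone f)) := by
  obtain ⟨a, b, ha, hb, hK⟩ := hK
  obtain ⟨a', b', ha', hb', hL⟩ := hL
  refine ⟨CochainComplex.mappingCone f, min (a - 1) a', max (b - 1) b', ?_, ?_, ?_, ⟨Iso.refl _⟩⟩
  · rw [CochainComplex.isStrictlyGE_iff]
    intro i hi
    rw [CochainComplex.mappingCone.isZero_X_iff]
    exact ⟨K.isZero_of_isStrictlyGE a _ (by grind), L.isZero_of_isStrictlyGE a' _ (by grind)⟩
  · rw [CochainComplex.isStrictlyLE_iff]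
    intro i hi
    rw [CochainComplex.mappingCone.isZero_X_iff]
    exact ⟨K.isZero_of_isStrictlyLE b _ (by grind), L.isZero_of_isStrictlyLE b' _ (by grind)⟩
  · intro i
    let e := HomologicalComplex.homotopyCofiber.XIsoBiprod f i (i + 1) rfl
    have : PreservesBinaryBiproducts (forget₂ (FGModuleCat.{u} R) (ModuleCat.{u} R)) :=
      preservesBinaryBiproducts_of_preservesBinaryProducts _
    let e' := (forget₂ (FGModuleCat.{u} R) (ModuleCat.{u} R)).mapIso e ≪≫
      (forget₂ (FGModuleCat.{u} R) (ModuleCat.{u} R)).mapBiprod _ _ ≪≫ ModuleCat.biprodIsoProd _ _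
    have := hK (i + 1)
    have := hL i
    exact Module.Projective.of_equiv (M := (K.X (i + 1)) × (L.X i)) e'.toLinearEquiv.symm

instance perfectObj_isTriangulatedClosed₃ : (perfectObj R).IsTriangulatedClosed₃ :=
  .mk' (by
    rintro T hT ⟨K, a, b, ha, hb, hK, ⟨e⟩⟩ ⟨L, a', b', ha', hb', hL, ⟨e'⟩⟩
    have (i : ℤ) : Projective (K.X i) := projective_of_moduleProjective _ (hK i)
    have : K.IsKProjective := K.isKProjective_of_projective b
    obtain ⟨g, hg⟩ := (CochainComplex.IsKProjective.Qh_map_bijective K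
      ((HomotopyCategory.quotient _ _).obj L)).surjective
        ((DerivedCategory.quotientCompQhIso _).hom.app K ≫ e.inv ≫ T.mor₁ ≫ e'.hom ≫
          (DerivedCategory.quotientCompQhIso _).inv.app L)
    obtain ⟨f, rfl⟩ := (HomotopyCategory.quotient _ _).map_surjective g
    have hf : DerivedCategory.Q.map f = e.inv ≫ T.mor₁ ≫ e'.hom := by
      rw [← cancel_epi ((DerivedCategory.quotientCompQhIso _).hom.app K),
        ← DerivedCategory.quotientCompQhIso_hom_naturality, hg]
      simp
    obtain ⟨φ, _⟩ := exists_iso_of_arrow_iso _ _ hT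
      (DerivedCategory.mappingCone_triangle_distinguished f)
      (Arrow.isoMk e e' (by
        change e.hom ≫ DerivedCategory.Q.map f = T.mor₁ ≫ e'.hom
        rw [hf, Iso.hom_inv_id_assoc]))
    exact (perfectObj R).prop_of_iso (Triangle.π₃.mapIso φ).symm
      (perfectObj_mappingCone R f ⟨a, b, ha, hb, hK⟩ ⟨a', b', ha', hb', hL⟩))

instance perfectObj_isTriangulated : (perfectObj R).IsTriangulated where
  toIsTriangulatedClosed₂ := ObjectProperty.IsTriangulatedClosed₂.of_isTriangulatedClosed₃

/-- The perfect complexes as a full subcategory of the bounded derived category. -/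
def perfect : ObjectProperty (Db R) := (perfectObj R).inverseImage (DerivedCategory.Bounded.ι)

instance perfect_isClosedUnderIsomorphisms : (perfect R).IsClosedUnderIsomorphisms :=
  inferInstanceAs ((perfectObj R).inverseImage DerivedCategory.Bounded.ι).IsClosedUnderIsomorphisms

instance perfect_isTriangulated : (perfect R).IsTriangulated :=
  inferInstanceAs ((perfectObj R).inverseImage DerivedCategory.Bounded.ι).IsTriangulated

/-- The singularity category: the Verdier quotient of the bounded derived category by the perfect
complexes, i.e. the localization with respect to the morphisms whose cone is perfect. -/
abbrev Dsg : Type (u + 1) := (perfect R).trW.Localization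

/-- The quotient functor `D^b(R) ⥤ D_sg(R)`. -/
noncomputable abbrev Dsg.quot : Db R ⥤ Dsg R := (perfect R).trW.Q

/-- The canonical functor `mod R ⥤ D^b(R)`: a module is viewed as a complex in degree `0`. -/
noncomputable def modToDb : FGModuleCat.{u} R ⥤ Db R :=
  ObjectProperty.lift _ (DerivedCategory.singleFunctor (FGModuleCat.{u} R) 0) fun M =>
    ⟨⟨0, (inferInstance : ((DerivedCategory.singleFunctor _ 0).obj M).IsGE 0)⟩,
     ⟨0, (inferInstance : ((DerivedCategory.singleFunctor _ 0).obj M).IsLE 0)⟩⟩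

/-- The canonical functor `mod R ⥤ D_sg(R)`. -/
noncomputable def modToDsg : FGModuleCat.{u} R ⥤ Dsg R := modToDb R ⋙ Dsg.quot R

/-! ### Localization at a prime ideal -/

variable {R} (p : PrimeSpectrum R)

/-- Localization of finitely generated modules at a prime ideal, `M ↦ M_p`. -/
noncomputable def modLoc : FGModuleCat.{u} R ⥤ FGModuleCat.{u} (Localization.AtPrime p.asIdeal) :=
  ObjectProperty.lift _
    ((ModuleCat.isFG R).ι ⋙ ModuleCat.localizedModuleFunctor.{u} p.asIdeal.primeCompl) fun M => by
      have : Module.Finite R M.obj := M.property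
      exact Module.Finite.of_isLocalizedModule (M := M.obj)
        (Rₚ := Localization p.asIdeal.primeCompl)
        (Mₚ := M.obj.localizedModule p.asIdeal.primeCompl) p.asIdeal.primeCompl
        (M.obj.localizedModuleMkLinearMap p.asIdeal.primeCompl)

instance modLoc_additive : (modLoc p).Additive where
  map_add {M N f g} := by
    apply ObjectProperty.hom_ext
    exact (ModuleCat.localizedModuleFunctor.{u} p.asIdeal.primeCompl).map_add
      (f := f.hom) (g := g.hom)

instance modLoc_preservesFiniteLimits : PreservesFiniteLimits (modLoc p) := by
  have : PreservesFiniteLimits (modLoc p ⋙ forget₂ (FGModuleCat (Localization.AtPrime p.asIdeal))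
      (ModuleCat (Localization.AtPrime p.asIdeal))) :=
    inferInstanceAs (PreservesFiniteLimits (forget₂ (FGModuleCat.{u} R) (ModuleCat.{u} R) ⋙
      ModuleCat.localizedModuleFunctor.{u} p.asIdeal.primeCompl))
  exact preservesFiniteLimits_of_reflects_of_preserves (modLoc p)
    (forget₂ (FGModuleCat (Localization.AtPrime p.asIdeal))
      (ModuleCat (Localization.AtPrime p.asIdeal)))

instance modLoc_preservesFiniteColimits : PreservesFiniteColimits (modLoc p) := by
  have : PreservesFiniteColimits (modLoc p ⋙ forget₂ (FGModuleCat (Localization.AtPrime p.asIdeal))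
      (ModuleCat (Localization.AtPrime p.asIdeal))) :=
    inferInstanceAs (PreservesFiniteColimits (forget₂ (FGModuleCat.{u} R) (ModuleCat.{u} R) ⋙
      ModuleCat.localizedModuleFunctor.{u} p.asIdeal.primeCompl))
  exact preservesFiniteColimits_of_reflects_of_preserves (modLoc p)
    (forget₂ (FGModuleCat (Localization.AtPrime p.asIdeal))
      (ModuleCat (Localization.AtPrime p.asIdeal)))

/-- Localization of bounded complexes at a prime ideal, `X ↦ X_p`. -/
noncomputable def dbLoc : Db R ⥤ Db (Localization.AtPrime p.asIdeal) :=
  ObjectProperty.lift _ (DerivedCategory.Bounded.ι ⋙ (modLoc p).mapDerivedCategory) <| by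
    rintro ⟨X, ⟨a, K, e, hK⟩, ⟨b, L, e', hL⟩⟩
    refine ⟨⟨a, ((modLoc p).mapHomologicalComplex _).obj K,
      (modLoc p).mapDerivedCategory.mapIso e ≪≫ (modLoc p).mapDerivedCategoryFactors.app K, ?_⟩,
      ⟨b, ((modLoc p).mapHomologicalComplex _).obj L,
      (modLoc p).mapDerivedCategory.mapIso e' ≪≫ (modLoc p).mapDerivedCategoryFactors.app L, ?_⟩⟩
    · rw [CochainComplex.isStrictlyGE_iff]
      intro i hi
      exact (modLoc p).map_isZero (K.isZero_of_isStrictlyGE a i hi)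
    · rw [CochainComplex.isStrictlyLE_iff]
      intro i hi
      exact (modLoc p).map_isZero (L.isZero_of_isStrictlyLE b i hi)

noncomputable instance dbLoc_commShift : (dbLoc p).CommShift ℤ := by
  unfold dbLoc
  infer_instance

instance dbLoc_isTriangulated : (dbLoc p).IsTriangulated := by
  unfold dbLoc
  exact ObjectProperty.isTriangulated_lift _ _ _

theorem perfect_dbLoc :
    perfect R ≤ (perfect (Localization.AtPrime p.asIdeal)).inverseImage (dbLoc p) := by
  rintro X ⟨K, a, b, ha, hb, hK, ⟨e⟩⟩
  refine ⟨((modLoc p).mapHomologicalComplex _).obj K, a, b, ?_, ?_, ?_,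
    ⟨(modLoc p).mapDerivedCategory.mapIso e ≪≫ (modLoc p).mapDerivedCategoryFactors.app K⟩⟩
  · rw [CochainComplex.isStrictlyGE_iff]
    intro i hi
    exact (modLoc p).map_isZero (K.isZero_of_isStrictlyGE a i hi)
  · rw [CochainComplex.isStrictlyLE_iff]
    intro i hi
    exact (modLoc p).map_isZero (K.isZero_of_isStrictlyLE b i hi)
  · intro i
    have := hK i
    exact Module.projective_of_isLocalizedModule (M := (K.X i).obj)
      (Rₛ := Localization p.asIdeal.primeCompl)
      (Mₛ := (K.X i).obj.localizedModule p.asIdeal.primeCompl) p.asIdeal.primeCompl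
      ((K.X i).obj.localizedModuleMkLinearMap p.asIdeal.primeCompl)

/-- The functor `D_sg(R) ⥤ D_sg(R_p)` induced by localization at the prime ideal `p`. -/
noncomputable def dsgLoc : Dsg R ⥤ Dsg (Localization.AtPrime p.asIdeal) :=
  CategoryTheory.Localization.lift
    (dbLoc p ⋙ Dsg.quot (Localization.AtPrime p.asIdeal))
    (fun _ _ f hf => ObjectProperty.inverseImage_trW_isInverted _ (dbLoc p)
      (Dsg.quot (Localization.AtPrime p.asIdeal)) f
      (ObjectProperty.trW_monotone (perfect_dbLoc p) _ hf))
    (Dsg.quot R)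

/-! ### The subcategories in question -/

variable (R)

/-- The finitely generated `R`-modules `M` such that `M_p` is `R_p`-free for every prime ideal `p`
outside `Φ`. -/
def modPhi (Φ : Set (PrimeSpectrum R)) : ObjectProperty (FGModuleCat.{u} R) := fun M =>
  ∀ p ∈ Φᶜ, Module.Free (Localization.AtPrime p.asIdeal) (LocalizedModule p.asIdeal.primeCompl M)

/-- The objects `X` of the singularity category such that `X_p ≅ 0` in the singularity category of
`R_p` for every prime ideal `p` outside `Φ`. -/
def dsgPhi (Φ : Set (PrimeSpectrum R)) : ObjectProperty (Dsg R) := fun X =>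
  ∀ p ∈ Φᶜ, IsZero ((dsgLoc p).obj X)

/-- The `R`-modules of finite length. -/
def fl : ObjectProperty (FGModuleCat.{u} R) := fun M => IsFiniteLength R M

/-- The image of the finite length modules in the singularity category (closed under
isomorphisms). -/
def flDsg : ObjectProperty (Dsg R) := (fl R).map (modToDsg R)

end Singularity

/-! Modules. Localization at a nonmaximal prime is exact, preserves projectives and kills `fl R`.
Projectives are closed under summands, extensions and kernels of epimorphisms between them, so every
ball around `fl R` consists of modules free on the punctured spectrum.

Conversely, let $M$ be free on the punctured spectrum. The ideal of elements whose action on $M$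
factors through a projective lies in no nonmaximal prime (`not_stableAnnihilator_le`). If it is the
unit ideal, $M$ is projective. Otherwise it contains $x_1,\dots,x_d$ generating an ideal whose
radical is $\mathfrak m$. Take a projective resolution $P$ of $M$ and form successive mapping cones
of $x_1,\dots,x_d$, a Koszul-type complex $Q$. Every homology class of $Q$ is killed by a power of
each $x_j$, so the homology has finite length. Since each $x_j$ is null-homotopic on $P$ in positive
degrees, each cone splits there far enough that $M$ is a summand of the cokernel of $Q_{d+1}\to Q_d$
(`exists_iterated_cone`). That cokernel is built from $H_0,\dots,H_d$ by $d$ extensions and syzygies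
(`abBall_coker`), hence lies in $[\mathrm{fl}]_{d+1}$.

Singularity category. One inclusion holds because vanishing at a prime is a thick condition. For the
other, each object is a shift of a module $M$. If $M_{\mathfrak p}$ vanishes it has finite
projective dimension, and quasi-compactness yields one syzygy of $M$ that is free at all nonmaximal
primes. The module statement applies to that syzygy, and syzygies are shifts in $\mathrm
D_{\mathrm{sg}}(R)$. -/

/-! ### Brackets and balls of finitely generated modules in terms of linear maps. -/

section FGModule

variable {R : Type u} [CommRing R] [IsNoetherianRing R]

theorem fgModule_shortExact_iff (S : ShortComplex (FGModuleCat.{u} R)) :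
    S.ShortExact ↔ Function.Injective S.f.hom.hom ∧
      Function.Exact S.f.hom.hom S.g.hom.hom ∧ Function.Surjective S.g.hom.hom := by
  have hex : S.Exact ↔ Function.Exact S.f.hom.hom S.g.hom.hom := by
    rw [← ShortComplex.exact_map_iff_of_faithful S (forget₂ (FGModuleCat R) (ModuleCat R)),
      ShortComplex.ShortExact.moduleCat_exact_iff_function_exact]
    rfl
  constructor
  · intro h
    have := h.mono_f
    have := h.epi_g
    refine ⟨?_, hex.1 h.exact, ?_⟩
    · have : Mono ((forget₂ (FGModuleCat R) (ModuleCat R)).map S.f) := inferInstance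
      exact (ModuleCat.mono_iff_injective _).1 this
    · have : Epi ((forget₂ (FGModuleCat R) (ModuleCat R)).map S.g) := inferInstance
      exact (ModuleCat.epi_iff_surjective _).1 this
  · rintro ⟨h₁, h₂, h₃⟩
    have : Mono S.f := (forget₂ (FGModuleCat R) (ModuleCat R)).mono_of_mono_map
      ((ModuleCat.mono_iff_injective _).2 h₁)
    have : Epi S.g := (forget₂ (FGModuleCat R) (ModuleCat R)).epi_of_epi_map
      ((ModuleCat.epi_iff_surjective _).2 h₃)
    exact { exact := hex.2 h₂ }

theorem moduleProjective_of_projective (M : FGModuleCat.{u} R) [Projective M] :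
    Module.Projective R M := by
  obtain ⟨n, f, hf⟩ := Module.Finite.exists_fin' R M
  let g : ULift.{u} (Fin n) → R →ₗ[R] M := fun i => LinearMap.toSpanSingleton R M (f (Pi.single i.down 1))
  let e : (ULift.{u} (Fin n) → R) ≃ₗ[R] (Fin n → R) := LinearEquiv.funCongrLeft R R Equiv.ulift.symm
  let q : FGModuleCat.of R (ULift.{u} (Fin n) → R) ⟶ M :=
    ObjectProperty.homMk (ModuleCat.ofHom (f ∘ₗ e.toLinearMap))
  have : Epi q := (forget₂ (FGModuleCat R) (ModuleCat R)).epi_of_epi_map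
    ((ModuleCat.epi_iff_surjective _).2 (hf.comp e.surjective))
  have h : Projective.factorThru (𝟙 M) q ≫ q = 𝟙 M := by simp
  refine Module.Projective.of_split (M := ULift.{u} (Fin n) → R)
    (Projective.factorThru (𝟙 M) q).hom.hom q.hom.hom ?_
  exact congrArg (fun t => t.hom.hom) h

theorem projective_iff_moduleProjective (M : FGModuleCat.{u} R) :
    Projective M ↔ Module.Projective R M :=
  ⟨fun _ => moduleProjective_of_projective M, projective_of_moduleProjective M⟩

/-- A finitely generated free module mapping onto a given finitely generated module. -/
theorem exists_free_cover (M : FGModuleCat.{u} R) :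
    ∃ (F : FGModuleCat.{u} R) (π : F →ₗ[R] M), Module.Free R F ∧ Function.Surjective π := by
  obtain ⟨n, f, hf⟩ := Module.Finite.exists_fin' R M
  let e : (ULift.{u} (Fin n) → R) ≃ₗ[R] (Fin n → R) := LinearEquiv.funCongrLeft R R Equiv.ulift.symm
  refine ⟨FGModuleCat.of R (ULift.{u} (Fin n) → R), f ∘ₗ e.toLinearMap, ?_, hf.comp e.surjective⟩
  exact inferInstanceAs (Module.Free R (ULift.{u} (Fin n) → R))

section TypeLevel

variable {P Q : ObjectProperty (FGModuleCat.{u} R)}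
variable {M N : Type u} [AddCommGroup M] [Module R M] [Module.Finite R M]
  [AddCommGroup N] [Module R N] [Module.Finite R N]

theorem abBracket_of_linearRetract (i : M →ₗ[R] N) (r : N →ₗ[R] M) (h : ∀ x, r (i x) = x)
    (hN : abBracket P (FGModuleCat.of R N)) : abBracket P (FGModuleCat.of R M) :=
  abBracket.retract ⟨FGModuleCat.ofHom i, FGModuleCat.ofHom r, by ext x; exact h x⟩ hN

theorem abBracket_of_moduleProjective [Module.Projective R M] :
    abBracket P (FGModuleCat.of R M) :=
  abBracket.of_projective _ (projective_of_moduleProjective _ (inferInstanceAs (Module.Projective R M)))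

theorem abBracket_prod (hM : abBracket P (FGModuleCat.of R M))
    (hN : abBracket P (FGModuleCat.of R N)) : abBracket P (FGModuleCat.of R (M × N)) := by
  refine abBracket.retract ⟨biprod.lift (FGModuleCat.ofHom (LinearMap.fst R M N))
    (FGModuleCat.ofHom (LinearMap.snd R M N)),
    biprod.desc (FGModuleCat.ofHom (LinearMap.inl R M N)) (FGModuleCat.ofHom (LinearMap.inr R M N)),
    ?_⟩ (abBracket.biprod _ _ hM hN)
  rw [biprod.lift_desc]
  refine FGModuleCat.hom_ext (LinearMap.ext fun (x : M × N) => ?_)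
  change ((x.1, 0) : M × N) + (0, x.2) = x
  simp

theorem abBracket_ker (g : M →ₗ[R] N) [Module.Projective R M] (hg : Function.Surjective g)
    (hN : abBracket P (FGModuleCat.of R N)) : abBracket P (FGModuleCat.of R (LinearMap.ker g)) := by
  refine abBracket.syzygy (ShortComplex.mk (FGModuleCat.ofHom (LinearMap.ker g).subtype)
    (FGModuleCat.ofHom g) ?_) ?_ ?_ hN
  · ext x
    exact x.2
  · rw [fgModule_shortExact_iff]
    exact ⟨Subtype.val_injective, LinearMap.exact_subtype_ker_map g, hg⟩
  · exact projective_of_moduleProjective _ (inferInstanceAs (Module.Projective R M))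

/-- The retracts of extensions of an object of `[Q]` by an object of `[P]`. -/
def abRetractExtension (P Q : ObjectProperty (FGModuleCat.{u} R)) :
    ObjectProperty (FGModuleCat.{u} R) := fun M =>
  ∃ (X Z Y : FGModuleCat.{u} R) (f : X →ₗ[R] Z) (g : Z →ₗ[R] Y) (i : M →ₗ[R] Z) (r : Z →ₗ[R] M),
    Function.Injective f ∧ Function.Exact f g ∧ Function.Surjective g ∧ (∀ x, r (i x) = x) ∧
      abBracket P X ∧ abBracket Q Y

theorem abExtension_of_linear {X Z Y : FGModuleCat.{u} R} (f : X →ₗ[R] Z) (g : Z →ₗ[R] Y)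
    (hf : Function.Injective f) (hfg : Function.Exact f g) (hg : Function.Surjective g)
    (hX : P X) (hY : Q Y) : abExtension P Q Z :=
  ⟨X, Y, ObjectProperty.homMk (ModuleCat.ofHom f), ObjectProperty.homMk (ModuleCat.ofHom g),
    by ext x; exact hfg.apply_apply_eq_zero x, (fgModule_shortExact_iff _).2 ⟨hf, hfg, hg⟩, hX, hY⟩

theorem abBullet_of_abRetractExtension {M : FGModuleCat.{u} R} (h : abRetractExtension P Q M) :
    abBullet P Q M := by
  obtain ⟨X, Z, Y, f, g, i, r, hf, hfg, hg, hir, hX, hY⟩ := h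
  exact abBracket_of_linearRetract (N := Z) i r hir
    (abBracket.of_mem _ (abExtension_of_linear f g hf hfg hg hX hY))

/-- The kernel of a surjection from a projective module onto a retract of an extension is again a
retract of an extension. -/
theorem abRetractExtension_syzygy {M F M' : FGModuleCat.{u} R} [Module.Projective R F]
    (ι : M →ₗ[R] F) (π : F →ₗ[R] M') (hι : Function.Injective ι) (hιπ : Function.Exact ι π)
    (hπ : Function.Surjective π) (h : abRetractExtension P Q M') : abRetractExtension P Q M := by
  obtain ⟨X, Z, Y, f, g, i, r, hf, hfg, hg, hir, hX, hY⟩ := h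
  obtain ⟨GX, pX, hGX, hpX⟩ := exists_free_cover X
  obtain ⟨GY, pY, hGY, hpY⟩ := exists_free_cover Y
  obtain ⟨s, hs⟩ := Module.projective_lifting_property g pY hg
  replace hs (y : GY) : g (s y) = pY y := LinearMap.congr_fun hs y
  -- Horseshoe lemma: `p` covers the middle term, and `ker p` is an extension of `ker pY` by `ker
  -- pX`.
  let p : (GX × GY) →ₗ[R] Z := (f ∘ₗ pX).coprod s
  have hp (x : GX × GY) : p x = f (pX x.1) + s x.2 := by simp [p]
  have hps : Function.Surjective p := by
    intro z
    obtain ⟨y, hy⟩ := hpY (g z)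
    obtain ⟨x, hx⟩ := (hfg (z - s y)).1 (by rw [map_sub, hs, hy, sub_self])
    obtain ⟨x', rfl⟩ := hpX x
    exact ⟨(x', y), by rw [hp, hx]; abel⟩
  -- The lifts of `i` and `r` need not satisfy `β ∘ α = id`, but `id - β ∘ α` takes values in `ker
  -- π`. The extra summand `F` absorbs this error.
  obtain ⟨α, hα⟩ := Module.projective_lifting_property p (i ∘ₗ π) hps
  obtain ⟨β, hβ⟩ := Module.projective_lifting_property π (r ∘ₗ p) hπ
  replace hα (x : F) : p (α x) = i (π x) := LinearMap.congr_fun hα x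
  replace hβ (x : GX × GY) : π (β x) = r (p x) := LinearMap.congr_fun hβ x
  -- the retraction of `ker π` from `ker p × F`
  let e : M ≃ₗ[R] LinearMap.ker π :=
    (LinearEquiv.ofInjective ι hι).trans (LinearEquiv.ofEq _ _ hιπ.linearMap_ker_eq.symm)
  have he (m : M) : ((e m : LinearMap.ker π) : F) = ι m := rfl
  have hιπ' (m : M) : π (ι m) = 0 := hιπ.apply_apply_eq_zero m
  let i' : M →ₗ[R] (LinearMap.ker p × F) :=
    LinearMap.prod (LinearMap.codRestrict _ (α ∘ₗ ι) fun m => by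
      simp [hα, hιπ']) ι
  let r₀ : (LinearMap.ker p × F) →ₗ[R] F :=
    LinearMap.coprod (β ∘ₗ (LinearMap.ker p).subtype) (LinearMap.id - β ∘ₗ α)
  let r' : (LinearMap.ker p × F) →ₗ[R] M := e.symm.toLinearMap ∘ₗ
    LinearMap.codRestrict (LinearMap.ker π) r₀ (by
      rintro ⟨⟨w, hw⟩, x⟩
      have hw' : p w = 0 := hw
      simp [r₀, hβ, hw', hα, hir])
  -- the extension
  let f' : (LinearMap.ker pX × F) →ₗ[R] (LinearMap.ker p × F) :=
    LinearMap.prodMap (LinearMap.codRestrict _ (LinearMap.inl R GX GY ∘ₗ (LinearMap.ker pX).subtype)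
      (by rintro ⟨x, hx⟩; have hx' : pX x = 0 := hx; simp [hp, hx'])) LinearMap.id
  let g' : (LinearMap.ker p × F) →ₗ[R] LinearMap.ker pY :=
    LinearMap.codRestrict _ (LinearMap.snd R GX GY ∘ₗ (LinearMap.ker p).subtype) (by
      rintro ⟨x, hx⟩
      have hx' : f (pX x.1) + s x.2 = 0 := by rw [← hp]; exact hx
      have := congrArg g hx'
      simpa [hs, hfg.apply_apply_eq_zero] using this) ∘ₗ LinearMap.fst R _ _
  refine ⟨FGModuleCat.of R (LinearMap.ker pX × F), FGModuleCat.of R (LinearMap.ker p × F),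
    FGModuleCat.of R (LinearMap.ker pY), f', g', i', r', ?_, ?_, ?_, ?_, ?_, ?_⟩
  · rintro ⟨⟨a, ha⟩, b⟩ ⟨⟨a', ha'⟩, b'⟩ h
    simp [f', Prod.ext_iff, Subtype.ext_iff] at h
    simp [h.1, h.2]
  · rintro ⟨⟨⟨a, c⟩, ha⟩, b⟩
    constructor
    · intro h
      have hc : c = 0 := congrArg Subtype.val h
      have ha' : f (pX a) + s c = 0 := by have := hp (a, c); rw [← this]; exact ha
      have : pX a = 0 := hf (by simpa [hc] using ha')
      exact ⟨(⟨a, this⟩, b), by simp [f', Prod.ext_iff, Subtype.ext_iff, hc]⟩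
    · rintro ⟨⟨⟨a', ha'⟩, b'⟩, h⟩
      simp [f', Prod.ext_iff, Subtype.ext_iff] at h
      exact Subtype.ext h.1.2.symm
  · rintro ⟨y, hy⟩
    have hy' : pY y = 0 := hy
    obtain ⟨x, hx⟩ := (hfg (s y)).1 (by rw [hs, hy'])
    obtain ⟨x', rfl⟩ := hpX x
    exact ⟨(⟨(-x', y), by simp [hp, hx]⟩, 0), Subtype.ext rfl⟩
  · intro m
    change e.symm _ = m
    rw [LinearEquiv.symm_apply_eq]
    apply Subtype.ext
    rw [he]
    simp [r₀, i']
  · exact abBracket_prod (abBracket_ker pX hpX hX) abBracket_of_moduleProjective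
  · exact abBracket_ker pY hpY hY

/-- Normal form: retracts of extensions already contain the projectives and are closed under sums,
retracts and syzygies, so the outer bracket adds nothing more. An object of a ball can thus be
handled through a single short exact sequence. -/
theorem abRetractExtension_of_abBullet {M : FGModuleCat.{u} R} (h : abBullet P Q M) :
    abRetractExtension P Q M := by
  induction h with
  | of_mem Z hZ =>
    obtain ⟨X, Y, f, g, w, hS, hX, hY⟩ := hZ
    obtain ⟨h₁, h₂, h₃⟩ := (fgModule_shortExact_iff _).1 hS
    exact ⟨X, Z, Y, f.hom.hom, g.hom.hom, LinearMap.id, LinearMap.id, h₁, h₂, h₃, fun _ => rfl,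
      hX, hY⟩
  | of_projective Z hZ =>
    refine ⟨Z, Z, FGModuleCat.of R PUnit, LinearMap.id, 0, LinearMap.id, LinearMap.id,
      Function.injective_id, fun x => ⟨fun _ => ⟨x, rfl⟩, fun _ => rfl⟩, fun x => ⟨0, rfl⟩,
      fun _ => rfl, abBracket.of_projective _ hZ, abBracket_of_moduleProjective⟩
  | biprod Z Z' _ _ h h' =>
    obtain ⟨X, W, Y, f, g, i, r, hf, hfg, hg, hir, hX, hY⟩ := h
    obtain ⟨X', W', Y', f', g', i', r', hf', hfg', hg', hir', hX', hY'⟩ := h'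
    refine ⟨FGModuleCat.of R (X × X'), FGModuleCat.of R (W × W'), FGModuleCat.of R (Y × Y'),
      f.prodMap f', g.prodMap g',
      LinearMap.prod (i ∘ₗ (biprod.fst : Z ⊞ Z' ⟶ Z).hom.hom)
        (i' ∘ₗ (biprod.snd : Z ⊞ Z' ⟶ Z').hom.hom),
      LinearMap.coprod ((biprod.inl : Z ⟶ Z ⊞ Z').hom.hom ∘ₗ r)
        ((biprod.inr : Z' ⟶ Z ⊞ Z').hom.hom ∘ₗ r'),
      Function.Injective.prodMap hf hf', ?_, Function.Surjective.prodMap hg hg', ?_,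
      abBracket_prod hX hX', abBracket_prod hY hY'⟩
    · rintro ⟨a, b⟩
      constructor
      · intro h
        obtain ⟨a', rfl⟩ := (hfg a).1 (congrArg Prod.fst h)
        obtain ⟨b', rfl⟩ := (hfg' b).1 (congrArg Prod.snd h)
        exact ⟨(a', b'), rfl⟩
      · rintro ⟨⟨a', b'⟩, h⟩
        obtain ⟨rfl, rfl⟩ := Prod.ext_iff.1 h
        exact Prod.ext (hfg.apply_apply_eq_zero _) (hfg'.apply_apply_eq_zero _)
    · intro x
      have := congrArg (fun t => t.hom.hom x) (biprod.total (X := Z) (Y := Z'))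
      change (biprod.inl : Z ⟶ Z ⊞ Z').hom.hom (r (i _)) +
        (biprod.inr : Z' ⟶ Z ⊞ Z').hom.hom (r' (i' _)) = x
      rw [hir, hir']
      exact this
  | retract e _ h =>
    obtain ⟨X, W, Y, f, g, i, r, hf, hfg, hg, hir, hX, hY⟩ := h
    refine ⟨X, W, Y, f, g, i ∘ₗ e.i.hom.hom, e.r.hom.hom ∘ₗ r, hf, hfg, hg, ?_, hX, hY⟩
    intro x
    have := congrArg (fun t => t.hom.hom x) e.retract
    change e.r.hom.hom (r (i _)) = x
    rw [hir]
    exact this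
  | syzygy S hS hP _ h =>
    obtain ⟨h₁, h₂, h₃⟩ := (fgModule_shortExact_iff _).1 hS
    have := moduleProjective_of_projective S.X₂
    exact abRetractExtension_syzygy _ _ h₁ h₂ h₃ h

theorem abBracket_abBracket {M : FGModuleCat.{u} R} (h : abBracket (abBracket P) M) :
    abBracket P M := by
  induction h with
  | of_mem Z hZ => exact hZ
  | of_projective Z hZ => exact .of_projective _ hZ
  | biprod Z Z' _ _ h h' => exact .biprod _ _ h h'
  | retract e _ h => exact .retract e h
  | syzygy S hS hP _ h => exact .syzygy S hS hP h

theorem abBall_succ_bracket {n : ℕ} {M : FGModuleCat.{u} R}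
    (h : abBracket (abBall P (n + 1)) M) : abBall P (n + 1) M := by
  cases n with
  | zero => exact abBracket_abBracket h
  | succ n => exact abBracket_abBracket h

/-- Turns a closure property of all brackets into one of balls, by taking the ball itself as the
center. -/
theorem abBall_of_abBracket_abBall_imp {n : ℕ} {M N : FGModuleCat.{u} R}
    (h : ∀ P : ObjectProperty (FGModuleCat.{u} R), abBracket P M → abBracket P N)
    (hM : abBall P (n + 1) M) : abBall P (n + 1) N :=
  abBall_succ_bracket (h _ (.of_mem _ hM))

/-- An extension of an object of `[P]_{n+1}` by an object of `[P]` is in `[P]_{n+2}`. -/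
theorem abBall_extension {n : ℕ} {X Z Y : FGModuleCat.{u} R} (f : X →ₗ[R] Z) (g : Z →ₗ[R] Y)
    (hf : Function.Injective f) (hfg : Function.Exact f g) (hg : Function.Surjective g)
    (hX : abBracket P X) (hY : abBall P (n + 1) Y) : abBall P (n + 2) Z := by
  induction n generalizing Z Y with
  | zero =>
    exact .of_mem _ (abExtension_of_linear f g hf hfg hg (.of_mem _ hX) hY)
  | succ n ih =>
    obtain ⟨A, W, B, a, b, i, r, ha, hab, hb, hir, hA, hB⟩ := abRetractExtension_of_abBullet hY
    -- The definition of balls attaches the new piece on the other side, so the extension is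
    -- reassociated. Here `ker q` is the pullback of `Z` and `W` over `Y`, and `ker q'` that of `Z`
    -- and `A`. The latter is an extension of `A` by `X`, covered by induction. The former is an
    -- extension of `B` by the latter, and retracts onto `Z` because `W` retracts onto `Y`.
    let q : (Z × W) →ₗ[R] Y := g ∘ₗ LinearMap.fst R Z W - r ∘ₗ LinearMap.snd R Z W
    have hq (x : Z × W) : x ∈ LinearMap.ker q ↔ g x.1 = r x.2 := by
      simp [q, sub_eq_zero]
    let q' : (Z × A) →ₗ[R] Y := g ∘ₗ LinearMap.fst R Z A - (r ∘ₗ a) ∘ₗ LinearMap.snd R Z A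
    have hq' (x : Z × A) : x ∈ LinearMap.ker q' ↔ g x.1 = r (a x.2) := by
      simp [q', sub_eq_zero]
    have h₁ : abBall P (n + 2) (FGModuleCat.of R (LinearMap.ker q')) := by
      refine ih (Y := A) (LinearMap.codRestrict _ (LinearMap.inl R Z A ∘ₗ f)
        fun x => ?_) (LinearMap.snd R Z A ∘ₗ (LinearMap.ker q').subtype) ?_ ?_ ?_
        (abBall_succ_bracket hA)
      · rw [hq']; simp [hfg.apply_apply_eq_zero]
      · intro x y h
        exact hf (congrArg (fun t => t.1.1) h)
      · rintro ⟨⟨x, y⟩, h⟩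
        rw [hq'] at h
        constructor
        · intro hy
          change y = 0 at hy
          subst hy
          obtain ⟨x', rfl⟩ := (hfg x).1 (by simpa using h)
          exact ⟨x', rfl⟩
        · rintro ⟨x', h'⟩
          exact (congrArg (fun t => t.1.2) h').symm
      · intro y
        obtain ⟨x, hx⟩ := hg (r (a y))
        exact ⟨⟨(x, y), (hq' _).2 hx⟩, rfl⟩
    refine abBullet_of_abRetractExtension ⟨FGModuleCat.of R (LinearMap.ker q'),
      FGModuleCat.of R (LinearMap.ker q), B,
      LinearMap.codRestrict _ (LinearMap.prodMap LinearMap.id a ∘ₗ (LinearMap.ker q').subtype) ?_,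
      b ∘ₗ LinearMap.snd R Z W ∘ₗ (LinearMap.ker q).subtype,
      LinearMap.codRestrict _ (LinearMap.prod LinearMap.id (i ∘ₗ g)) ?_,
      LinearMap.fst R Z W ∘ₗ (LinearMap.ker q).subtype, ?_, ?_, ?_, ?_, .of_mem _ h₁, hB⟩
    · rintro ⟨x, hx⟩
      rw [hq'] at hx
      rw [hq]
      exact hx
    · intro x
      rw [hq]
      exact (hir _).symm
    · rintro ⟨⟨x, y⟩, h⟩ ⟨⟨x', y'⟩, h'⟩ e
      have e₁ : x = x' := congrArg (fun t => t.1.1) e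
      have e₂ : a y = a y' := congrArg (fun t => t.1.2) e
      have e₃ := ha e₂
      subst e₁ e₃
      rfl
    · rintro ⟨⟨x, y⟩, h⟩
      rw [hq] at h
      constructor
      · intro hy
        obtain ⟨y', rfl⟩ := (hab y).1 hy
        exact ⟨⟨(x, y'), (hq' _).2 h⟩, rfl⟩
      · rintro ⟨⟨⟨x', y'⟩, h''⟩, h'⟩
        have e : a y' = y := congrArg (fun t => t.1.2) h'
        change b y = 0
        rw [← e, hab.apply_apply_eq_zero]
    · intro z
      obtain ⟨y, rfl⟩ := hb z
      obtain ⟨x, hx⟩ := hg (r y)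
      exact ⟨⟨(x, y), (hq _).2 hx⟩, rfl⟩
    · intro x
      rfl

end TypeLevel

end FGModule

/-! ### Iterated mapping cones of multiplication maps on complexes of projectives. -/

section ProjComplex

/-- A chain complex of finitely generated projective modules in nonnegative degrees. -/
structure ProjComplex (R : Type u) [CommRing R] where
  X : ℕ → FGModuleCat.{u} R
  projective (i : ℕ) : Module.Projective R (X i)
  d (i : ℕ) : X (i + 1) →ₗ[R] X i
  d_d (i : ℕ) (z : X (i + 2)) : d i (d (i + 1) z) = 0

namespace ProjComplex

variable {R : Type u} [CommRing R]

/-- The objects of the mapping cone of multiplication by a ring element. -/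
def coneX (P : ProjComplex R) : ℕ → FGModuleCat.{u} R
  | 0 => P.X 0
  | i + 1 => FGModuleCat.of R (P.X (i + 1) × P.X i)

/-- The differential of the mapping cone of multiplication by a ring element. -/
def coneD (x : R) (P : ProjComplex R) : (i : ℕ) → P.coneX (i + 1) →ₗ[R] P.coneX i
  | 0 => (P.d 0).coprod (x • LinearMap.id)
  | i + 1 => LinearMap.prod ((P.d (i + 1)).coprod (x • LinearMap.id))
      (-(P.d i ∘ₗ LinearMap.snd R _ _))

theorem coneD_zero (x : R) (P : ProjComplex R) (a : P.X 1) (b : P.X 0) :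
    P.coneD x 0 (show (P.X 1 × P.X 0 : Type u) from (a, b)) = P.d 0 a + x • b := rfl

theorem coneD_succ (x : R) (P : ProjComplex R) (i : ℕ) (a : P.X (i + 2)) (b : P.X (i + 1)) :
    P.coneD x (i + 1) (show (P.X (i + 2) × P.X (i + 1) : Type u) from (a, b)) =
      (show (P.X (i + 1) × P.X i : Type u) from (P.d (i + 1) a + x • b, -P.d i b)) := rfl

/-- The mapping cone of multiplication by a ring element. -/
def cone (x : R) (P : ProjComplex R) : ProjComplex R where
  X := P.coneX
  projective i := by
    have := P.projective
    cases i with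
    | zero => exact this 0
    | succ i => exact inferInstanceAs (Module.Projective R (P.X (i + 1) × P.X i))
  d := P.coneD x
  d_d i := by
    rintro ⟨a, b⟩
    cases i with
    | zero =>
      rw [coneD_succ, coneD_zero]
      simp only [map_add, P.d_d, map_smul, smul_neg, zero_add, add_neg_cancel]
      rfl
    | succ i =>
      rw [coneD_succ, coneD_succ]
      simp only [map_add, P.d_d, map_smul, map_neg, smul_neg, neg_neg, zero_add]
      exact Prod.ext (add_neg_cancel _) rfl

/-- Every homology class is killed by a power of `y`. -/
structure HomologyTorsion (y : R) (P : ProjComplex R) : Prop where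
  zero (z : P.X 0) : ∃ (k : ℕ) (w : P.X 1), y ^ k • z = P.d 0 w
  succ (i : ℕ) (z : P.X (i + 1)) (hz : P.d i z = 0) :
    ∃ (k : ℕ) (w : P.X (i + 2)), y ^ k • z = P.d (i + 1) w

/-- Multiplication by `x` on its own cone is null-homotopic via $(a,b)\mapsto(0,a)$, so the first
power of `x` suffices. -/
theorem homologyTorsion_cone_self (x : R) (P : ProjComplex R) : HomologyTorsion x (P.cone x) where
  zero z := ⟨1, ((0, z) : P.X 1 × P.X 0), by
    change x ^ 1 • (show P.X 0 from z) = P.d 0 0 + x • (show P.X 0 from z)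
    rw [map_zero, zero_add, pow_one]⟩
  succ i := by
    rintro ⟨a, b⟩ hz
    refine ⟨1, ((0, a) : P.X (i + 2) × P.X (i + 1)), ?_⟩
    change ((x ^ 1 • a, x ^ 1 • b) : P.X (i + 1) × P.X i) = (P.d (i + 1) 0 + x • a, -P.d i a)
    have h : P.d i a + x • b = 0 := by
      cases i with
      | zero => exact hz
      | succ i => exact congrArg Prod.fst hz
    rw [map_zero, zero_add, pow_one, eq_neg_of_add_eq_zero_right h]

/-- An explicit form of the long exact sequence: the homology of the cone lies between two torsion
modules, so the exponents `k` and `l` add. -/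
theorem HomologyTorsion.cone {y : R} {P : ProjComplex R} (h : HomologyTorsion y P) (x : R) :
    HomologyTorsion y (P.cone x) where
  zero z := by
    obtain ⟨k, w, hw⟩ := h.zero z
    refine ⟨k, ((w, 0) : P.X 1 × P.X 0), ?_⟩
    change y ^ k • (show P.X 0 from z) = P.d 0 w + x • (0 : P.X 0)
    rw [hw, smul_zero, add_zero]
  succ i := by
    rintro ⟨a, b⟩ hz
    have h₁ : P.d i a + x • b = 0 := by
      cases i with
      | zero => exact hz
      | succ i => exact congrArg Prod.fst hz
    have h₂ : ∃ (k : ℕ) (w : P.X (i + 1)), y ^ k • b = P.d i w := by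
      cases i with
      | zero => exact h.zero b
      | succ i => exact h.succ i b (neg_eq_zero.1 (congrArg Prod.snd hz))
    obtain ⟨k, b', hb⟩ := h₂
    obtain ⟨l, a', ha⟩ := h.succ i (y ^ k • a + x • b') (by
      rw [map_add, map_smul, map_smul, ← hb, smul_comm x, ← smul_add, h₁, smul_zero])
    refine ⟨l + k, ((a', -(y ^ l • b')) : P.X (i + 2) × P.X (i + 1)), ?_⟩
    change ((y ^ (l + k) • a, y ^ (l + k) • b) : P.X (i + 1) × P.X i) =
      (P.d (i + 1) a' + x • (-(y ^ l • b')), -P.d i (-(y ^ l • b')))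
    rw [← ha, map_neg, map_smul, ← hb, neg_neg, pow_add, mul_smul, mul_smul, smul_add, smul_neg,
      smul_comm x, add_neg_cancel_right]

/-- A homotopy between multiplication by `x` and zero in degrees greater than `n`. -/
structure PartialHomotopy (x : R) (n : ℕ) (P : ProjComplex R) where
  h (i : ℕ) : P.X i →ₗ[R] P.X (i + 1)
  comm (i : ℕ) (hi : n ≤ i) (z : P.X (i + 1)) : h i (P.d i z) + P.d (i + 1) (h (i + 1) z) = x • z

/-- The extension of a partial homotopy to the mapping cone. -/
def PartialHomotopy.cone {y : R} {n : ℕ} {P : ProjComplex R} (H : PartialHomotopy y n P) (x : R) :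
    PartialHomotopy y (n + 1) (P.cone x) where
  h
    | 0 => LinearMap.prod (H.h 0) 0
    | i + 1 => LinearMap.prodMap (H.h (i + 1)) (-H.h i)
  comm i hi := by
    rintro ⟨a, b⟩
    obtain ⟨i, rfl⟩ : ∃ j, i = j + 1 := ⟨i - 1, by lia⟩
    change ((H.h (i + 1) (P.d (i + 1) a + x • b), -H.h i (-P.d i b)) :
        P.X (i + 2) × P.X (i + 1)) +
      (P.d (i + 2) (H.h (i + 2) a) + x • (-H.h (i + 1) b), -P.d (i + 1) (-H.h (i + 1) b)) =
        (y • a, y • b)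
    rw [← H.comm (i + 1) (by lia) a, ← H.comm i (by lia) b]
    refine Prod.ext ?_ ?_
    · simp only [Prod.mk_add_mk, map_add, map_smul, smul_neg]
      rw [add_add_add_comm, add_neg_cancel, add_zero]
    · simp only [Prod.mk_add_mk, map_neg, neg_neg]

/-- The cokernel of the differential ending in degree `i`. -/
abbrev coker (P : ProjComplex R) (i : ℕ) : FGModuleCat.{u} R :=
  FGModuleCat.of R (P.X i ⧸ LinearMap.range (P.d i))

/-- A null-homotopic map has a split cone: $b\mapsto(-hb,b)$ is a section of the projection to the
shifted copy of $P$. On cokernels in degree `n` the homotopy identity is needed only on `P.X (n +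
1)`, where it is available. -/
theorem PartialHomotopy.exists_retract {x : R} {n : ℕ} {P : ProjComplex R}
    (H : PartialHomotopy x n P) :
    ∃ (i : P.coker n →ₗ[R] (P.cone x).coker (n + 1)) (r : (P.cone x).coker (n + 1) →ₗ[R] P.coker n),
      ∀ z, r (i z) = z := by
  refine ⟨Submodule.mapQ _ _ (LinearMap.prod (-H.h n) LinearMap.id :
      P.X n →ₗ[R] (P.X (n + 1) × P.X n)) ?_,
    Submodule.mapQ _ _ (LinearMap.snd R (P.X (n + 1)) (P.X n)) ?_, ?_⟩
  · rintro _ ⟨b, rfl⟩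
    refine ⟨((H.h (n + 1) b, -b) : P.X (n + 2) × P.X (n + 1)), ?_⟩
    change ((P.d (n + 1) (H.h (n + 1) b) + x • (-b), -P.d n (-b)) : P.X (n + 1) × P.X n) =
      (-H.h n (P.d n b), P.d n b)
    rw [smul_neg, ← H.comm n le_rfl b, map_neg, neg_neg]
    exact Prod.ext (by rw [neg_add_rev, add_neg_cancel_left]) rfl
  · rintro _ ⟨⟨a, b⟩, rfl⟩
    refine ⟨-b, ?_⟩
    change P.d n (-b) = -P.d n b
    rw [map_neg]
  · intro z
    obtain ⟨b, rfl⟩ := Submodule.Quotient.mk_surjective _ z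
    rfl

/-- Each cone makes one more element torsion, while homotopies and retracts move up one degree;
hence `m = n + l.length`. The clause on arbitrary `y` carries torsion already obtained through the
later cones. -/
theorem exists_iterated_cone (l : List R) (n m : ℕ) (hm : m = n + l.length) (P : ProjComplex R)
    (hP : ∀ x ∈ l, Nonempty (PartialHomotopy x n P)) :
    ∃ Q : ProjComplex R, (∀ x ∈ l, HomologyTorsion x Q) ∧
      (∀ y, HomologyTorsion y P → HomologyTorsion y Q) ∧
      ∃ (i : P.coker n →ₗ[R] Q.coker m) (r : Q.coker m →ₗ[R] P.coker n),
        ∀ z, r (i z) = z := by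
  induction l generalizing n P with
  | nil =>
    obtain rfl : m = n := hm
    exact ⟨P, by simp, fun _ h => h, LinearMap.id, LinearMap.id, fun _ => rfl⟩
  | cons x l ih =>
    obtain ⟨Q, h₁, h₂, i, r, hir⟩ := ih (n + 1) (by simp [hm]; lia) (P.cone x)
      fun y hy => (hP y (List.mem_cons_of_mem _ hy)).map fun H => H.cone x
    obtain ⟨i', r', hir'⟩ := (hP x List.mem_cons_self).some.exists_retract
    refine ⟨Q, ?_, fun y hy => h₂ y (hy.cone x), i ∘ₗ i', r' ∘ₗ r, fun z => ?_⟩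
    · intro y hy
      obtain rfl | hy := List.mem_cons.1 hy
      · exact h₂ _ (homologyTorsion_cone_self _ P)
      · exact h₁ y hy
    · rw [LinearMap.comp_apply, LinearMap.comp_apply, hir, hir']

/-- The map induced by the differential on the cokernel of the preceding differential. -/
def cokerD (P : ProjComplex R) (i : ℕ) : P.coker (i + 1) →ₗ[R] P.X i :=
  Submodule.liftQ _ (P.d i) (by rintro _ ⟨z, rfl⟩; exact P.d_d i z)

/-- The kernel of `P.cokerD i` is $H_{i+1}$, and its image is the kernel of
$P_i\to\operatorname{coker}_i$, a syzygy of the previous cokernel. Thus each degree costs one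
extension by homology. -/
theorem abBall_coker [IsNoetherianRing R] {C : ObjectProperty (FGModuleCat.{u} R)}
    (P : ProjComplex R) (h₀ : C (P.coker 0))
    (h : ∀ i, C (FGModuleCat.of R (LinearMap.ker (P.cokerD i)))) (i : ℕ) :
    abBall C (i + 1) (P.coker i) := by
  induction i with
  | zero => exact .of_mem _ h₀
  | succ i ih =>
    have := P.projective i
    let π : P.X i →ₗ[R] P.coker i := Submodule.mkQ _
    refine abBall_extension (Y := FGModuleCat.of R (LinearMap.ker π))
      (X := FGModuleCat.of R (LinearMap.ker (P.cokerD i)))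
      (LinearMap.ker (P.cokerD i)).subtype
      (LinearMap.codRestrict _ (P.cokerD i) fun z => ?_) Subtype.val_injective ?_ ?_
      (.of_mem _ (h i))
      (abBall_of_abBracket_abBall_imp (M := P.coker i)
        (fun _ => abBracket_ker π (Submodule.mkQ_surjective _)) ih)
    · obtain ⟨z, rfl⟩ := Submodule.Quotient.mk_surjective _ z
      exact (Submodule.Quotient.mk_eq_zero _).2 ⟨z, rfl⟩
    · rw [LinearMap.exact_iff, LinearMap.ker_codRestrict, Submodule.range_subtype]
    · rintro ⟨z, hz⟩
      obtain ⟨w, rfl⟩ := (Submodule.Quotient.mk_eq_zero _).1 hz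
      exact ⟨Submodule.Quotient.mk w, rfl⟩

end ProjComplex

end ProjComplex

/-! ### Finite length over a noetherian local ring and systems of parameters. -/

section FiniteLength

variable {R : Type u} [CommRing R] [IsNoetherianRing R] [IsLocalRing R]

theorem isFiniteLength_of_forall_exists_pow_smul_eq_zero {N : Type u} [AddCommGroup N] [Module R N]
    [Module.Finite R N] (h : ∀ r ∈ IsLocalRing.maximalIdeal R, ∀ z : N, ∃ k : ℕ, r ^ k • z = 0) :
    IsFiniteLength R N := by
  cases subsingleton_or_nontrivial N
  · exact .of_subsingleton
  have hle : IsLocalRing.maximalIdeal R ≤ (Module.annihilator R N).radical := by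
    intro r hr
    -- Finitely many generators allow one exponent for the whole module. A power of the maximal
    -- ideal then annihilates `N`, making it a finite module over an artinian quotient of `R`.
    obtain ⟨s, hs⟩ := (Module.Finite.fg_top : (⊤ : Submodule R N).FG)
    choose k hk using h r hr
    refine ⟨s.sup k, Module.mem_annihilator.2 fun z => ?_⟩
    have hz : z ∈ Submodule.span R (s : Set N) := hs ▸ Submodule.mem_top
    induction hz using Submodule.span_induction with
    | mem z hz =>
      obtain ⟨l, hl⟩ := Nat.exists_eq_add_of_le (Finset.le_sup (f := k) hz)
      rw [hl, add_comm, pow_add, mul_smul, hk, smul_zero]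
    | zero => simp
    | add _ _ _ _ h₁ h₂ => rw [smul_add, h₁, h₂, add_zero]
    | smul c _ _ h => rw [smul_comm, h, smul_zero]
  obtain ⟨n, hn⟩ := Ideal.exists_pow_le_of_le_radical_of_fg hle
    (IsNoetherian.noetherian (IsLocalRing.maximalIdeal R))
  have hne : Module.annihilator R N ≠ ⊤ := by
    rw [ne_eq, Module.annihilator_eq_top_iff, not_subsingleton_iff_nontrivial]
    infer_instance
  have : Nontrivial (R ⧸ Module.annihilator R N) := Ideal.Quotient.nontrivial_iff.2 hne
  have : IsLocalRing (R ⧸ Module.annihilator R N) :=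
    .of_surjective' (Ideal.Quotient.mk _) Ideal.Quotient.mk_surjective
  have : IsArtinianRing (R ⧸ Module.annihilator R N) := by
    rw [isArtinianRing_iff_isNilpotent_maximalIdeal]
    refine ⟨n, ?_⟩
    have hmap : IsLocalRing.maximalIdeal (R ⧸ Module.annihilator R N) ≤
        (IsLocalRing.maximalIdeal R).map (Ideal.Quotient.mk _) := by
      intro x hx
      obtain ⟨r, rfl⟩ := Ideal.Quotient.mk_surjective x
      exact Ideal.mem_map_of_mem _ fun hr => hx (hr.map _)
    rw [Ideal.zero_eq_bot, eq_bot_iff]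
    refine (Ideal.pow_right_mono hmap n).trans ?_
    rw [← Ideal.map_pow]
    exact (Ideal.map_mono hn).trans (Ideal.map_quotient_self _).le
  let _ : Module (R ⧸ Module.annihilator R N) N := Module.quotientAnnihilator
  have : IsScalarTower R (R ⧸ Module.annihilator R N) N :=
    Module.IsTorsionBySet.isScalarTower _
  have : Module.Finite (R ⧸ Module.annihilator R N) N :=
    Module.Finite.of_restrictScalars_finite R _ N
  rw [isFiniteLength_iff_isNoetherian_isArtinian]
  exact ⟨inferInstance,
    (isArtinian_of_surjective_algebraMap (R := R ⧸ Module.annihilator R N) (S := R)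
      Ideal.Quotient.mk_surjective : _)⟩

theorem IsFiniteLength.exists_pow_smul_eq_zero {N : Type u} [AddCommGroup N] [Module R N]
    (h : IsFiniteLength R N) {r : R} (hr : r ∈ IsLocalRing.maximalIdeal R) (z : N) :
    ∃ k : ℕ, r ^ k • z = 0 := by
  induction h with
  | of_subsingleton => exact ⟨0, Subsingleton.elim _ _⟩
  | @of_simple_quotient M _ _ N _ _ ih =>
    have hz : r • z ∈ N := by
      obtain ⟨I, hI, ⟨e⟩⟩ := isSimpleModule_iff_quot_maximal.1
        (inferInstance : IsSimpleModule R (M ⧸ N))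
      obtain rfl := IsLocalRing.eq_maximalIdeal hI
      rw [← Submodule.Quotient.mk_eq_zero, Submodule.Quotient.mk_smul]
      apply e.injective
      obtain ⟨s, hs⟩ := Submodule.Quotient.mk_surjective _ (e (Submodule.Quotient.mk z))
      rw [map_smul, ← hs, map_zero, ← Submodule.Quotient.mk_smul, Submodule.Quotient.mk_eq_zero]
      exact Ideal.mul_mem_right _ _ hr
    obtain ⟨k, hk⟩ := ih ⟨r • z, hz⟩
    exact ⟨k + 1, by rw [pow_succ, mul_smul]; exact congrArg Subtype.val hk⟩

theorem subsingleton_localizedModule_of_isFiniteLength {N : Type u} [AddCommGroup N] [Module R N]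
    (h : IsFiniteLength R N) {p : PrimeSpectrum R} (hp : p ≠ IsLocalRing.closedPoint R) :
    Subsingleton (LocalizedModule p.asIdeal.primeCompl N) := by
  obtain ⟨r, hr, hrp⟩ : ∃ r ∈ IsLocalRing.maximalIdeal R, r ∉ p.asIdeal := by
    by_contra! hle
    exact hp (PrimeSpectrum.ext ((IsLocalRing.le_maximalIdeal p.2.ne_top).antisymm hle))
  rw [LocalizedModule.subsingleton_iff]
  intro z
  obtain ⟨k, hk⟩ := h.exists_pow_smul_eq_zero hr z
  exact ⟨r ^ k, p.asIdeal.primeCompl.pow_mem hrp k, hk⟩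

/-- A system of parameters inside an ideal that is contained in no nonmaximal prime ideal. -/
theorem exists_list_maximalIdeal_le_radical {d : ℕ} (hd : ringKrullDim R = d) {I : Ideal R}
    (hI : I ≠ ⊤) (h : ∀ p : PrimeSpectrum R, p ≠ IsLocalRing.closedPoint R → ¬ I ≤ p.asIdeal) :
    ∃ l : List R, l.length = d ∧ (∀ x ∈ l, x ∈ I) ∧
      IsLocalRing.maximalIdeal R ≤ (Ideal.span {x | x ∈ l}).radical := by
  have hm : (IsLocalRing.maximalIdeal R).height = d := by
    have := IsLocalRing.maximalIdeal_height_eq_ringKrullDim (R := R)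
    rw [hd] at this
    exact_mod_cast this
  have hIh : I.height = d := by
    refine le_antisymm ?_ ?_
    · rw [← hm]
      exact Ideal.height_mono (IsLocalRing.le_maximalIdeal hI)
    · rw [Ideal.height_eq_inf_minimalPrimes]
      refine le_iInf₂ fun p hp => ?_
      have := hp.1.1
      have hpm : p = IsLocalRing.maximalIdeal R := by
        by_contra hne
        exact h ⟨p, this⟩ (fun e => hne (congrArg PrimeSpectrum.asIdeal e)) hp.1.2
      rw [hpm, hm]
  -- Converse of the height theorem: `J` lies in `I`, has height `d` and is generated by `d`
  -- elements. A prime over `J` other than the maximal ideal would have height less than `d`.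
  obtain ⟨J, hJI, hJr, hJh⟩ := Ideal.exists_spanRank_eq_and_height_eq I hI
  rw [hIh] at hJr hJh
  have hJfg : Submodule.FG J := IsNoetherian.noetherian J
  obtain ⟨s, hs, hsJ⟩ := Submodule.FG.exists_span_finset_card_eq_spanFinrank hJfg
  rw [(Submodule.FG.spanRank_eq_iff hJfg d).1 (hJr.trans (by simp))] at hs
  refine ⟨s.toList, by simpa using hs, ?_, ?_⟩
  · intro x hx
    apply hJI
    rw [← hsJ]
    exact Submodule.subset_span (by simpa using hx)
  · have hspan : Ideal.span {x | x ∈ s.toList} = J := by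
      rw [← hsJ]
      congr 1
      ext x
      simp
    rw [hspan, Ideal.radical_eq_sInf]
    refine le_sInf fun p hp => ?_
    have := hp.2
    by_contra hle
    have hlt : p < IsLocalRing.maximalIdeal R :=
      lt_of_le_of_ne (IsLocalRing.le_maximalIdeal hp.2.ne_top) fun e => hle e.ge
    have h₁ := Ideal.height_strict_mono_of_isPrime_of_isPrime hlt
    have h₂ := Ideal.height_mono hp.1
    rw [hm] at h₁
    rw [hJh] at h₂
    exact absurd (h₂.trans_lt h₁) (lt_irrefl _)

end FiniteLength

/-! ### Free resolutions, the stable annihilator and membership in balls. -/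

section Resolution

variable {R : Type u} [CommRing R] [IsNoetherianRing R]

namespace FGModuleCat

/-- A finitely generated free module mapping onto `M`. -/
noncomputable def freeCover (M : FGModuleCat.{u} R) : FGModuleCat.{u} R :=
  (exists_free_cover M).choose

/-- The chosen surjection from a free module. -/
noncomputable def freeCoverMap (M : FGModuleCat.{u} R) : M.freeCover →ₗ[R] M :=
  (exists_free_cover M).choose_spec.choose

instance (M : FGModuleCat.{u} R) : Module.Free R M.freeCover :=
  (exists_free_cover M).choose_spec.choose_spec.1

theorem freeCoverMap_surjective (M : FGModuleCat.{u} R) : Function.Surjective M.freeCoverMap :=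
  (exists_free_cover M).choose_spec.choose_spec.2

/-- The iterated syzygies of a finitely generated module. -/
noncomputable def syz (M : FGModuleCat.{u} R) : ℕ → FGModuleCat.{u} R
  | 0 => M
  | n + 1 => FGModuleCat.of R (LinearMap.ker (M.syz n).freeCoverMap)

/-- The inclusion of a syzygy in a free module. -/
noncomputable def syzInclusion (M : FGModuleCat.{u} R) (n : ℕ) :
    M.syz (n + 1) →ₗ[R] (M.syz n).freeCover :=
  (LinearMap.ker (M.syz n).freeCoverMap).subtype

theorem syzInclusion_injective (M : FGModuleCat.{u} R) (n : ℕ) :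
    Function.Injective (M.syzInclusion n) :=
  Subtype.val_injective

theorem syzInclusion_exact (M : FGModuleCat.{u} R) (n : ℕ) :
    Function.Exact (M.syzInclusion n) (M.syz n).freeCoverMap :=
  LinearMap.exact_subtype_ker_map _

theorem exists_resolution (M : FGModuleCat.{u} R) :
    ∃ (P : ProjComplex R) (π : P.X 0 →ₗ[R] M), Function.Surjective π ∧
      Function.Exact (P.d 0) π ∧ ∀ i, Function.Exact (P.d (i + 1)) (P.d i) := by
  have h (i : ℕ) : Function.Exact (M.syzInclusion i ∘ₗ (M.syz (i + 1)).freeCoverMap)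
      (M.syz i).freeCoverMap :=
    (Function.Surjective.comp_exact_iff_exact (freeCoverMap_surjective _)).2 (M.syzInclusion_exact i)
  have h' (i : ℕ) : Function.Exact (M.syzInclusion (i + 1) ∘ₗ (M.syz (i + 2)).freeCoverMap)
      (M.syzInclusion i ∘ₗ (M.syz (i + 1)).freeCoverMap) :=
    (Function.Injective.comp_exact_iff_exact (M.syzInclusion_injective i)).2 (h (i + 1))
  exact ⟨⟨fun i => (M.syz i).freeCover, fun i => inferInstance,
    fun i => M.syzInclusion i ∘ₗ (M.syz (i + 1)).freeCoverMap,
    fun i z => (h' i).apply_apply_eq_zero z⟩, M.freeCoverMap, freeCoverMap_surjective M, h 0, h'⟩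

/-- The ideal of ring elements whose action on `M` factors through a projective module. -/
def stableAnnihilator (M : FGModuleCat.{u} R) : Ideal R where
  carrier := {x | ∃ a : M →ₗ[R] M.freeCover, ∀ z, M.freeCoverMap (a z) = x • z}
  zero_mem' := ⟨0, by simp⟩
  add_mem' := by
    rintro x y ⟨a, ha⟩ ⟨b, hb⟩
    exact ⟨a + b, fun z => by simp [ha, hb, add_smul]⟩
  smul_mem' := by
    rintro c x ⟨a, ha⟩
    exact ⟨c • a, fun z => by simp [ha, mul_smul]⟩

theorem mem_stableAnnihilator {M : FGModuleCat.{u} R} {x : R} :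
    x ∈ M.stableAnnihilator ↔ ∃ a : M →ₗ[R] M.freeCover, ∀ z, M.freeCoverMap (a z) = x • z :=
  Iff.rfl

theorem projective_of_stableAnnihilator_eq_top {M : FGModuleCat.{u} R}
    (h : M.stableAnnihilator = ⊤) : Module.Projective R M := by
  obtain ⟨a, ha⟩ := mem_stableAnnihilator.1 ((Ideal.eq_top_iff_one _).1 h)
  exact Module.Projective.of_split a M.freeCoverMap (LinearMap.ext fun z => by simp [ha])

end FGModuleCat

/-- On `P.X 0` the difference `x - a ∘ π` lifts through `P.d 0`, and the comparison argument
continues upwards. The defect `a ∘ π` remains in degree zero, so the homotopy is only partial. -/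
theorem ProjComplex.nonempty_partialHomotopy {P : ProjComplex R} {M : FGModuleCat.{u} R}
    {π : P.X 0 →ₗ[R] M} (hπ : Function.Exact (P.d 0) π)
    (hP : ∀ i, Function.Exact (P.d (i + 1)) (P.d i)) {x : R} (a : M →ₗ[R] P.X 0)
    (ha : ∀ z, π (a z) = x • z) : Nonempty (PartialHomotopy x 0 P) := by
  have lift (i : ℕ) (f : P.X i →ₗ[R] P.X i) (hf : ∀ z, f z ∈ LinearMap.range (P.d i)) :
      ∃ h : P.X i →ₗ[R] P.X (i + 1), ∀ z, P.d i (h z) = f z := by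
    have := P.projective i
    obtain ⟨h, hh⟩ := Module.projective_lifting_property (P.d i).rangeRestrict
      (LinearMap.codRestrict _ f hf) (LinearMap.surjective_rangeRestrict _)
    exact ⟨h, fun z => congrArg Subtype.val (LinearMap.congr_fun hh z)⟩
  -- The condition carried along says that `x - h ∘ d` lands in cycles, exactly what the next lift
  -- needs.
  let S (i : ℕ) := {h : P.X i →ₗ[R] P.X (i + 1) // ∀ z, P.d i (x • z - h (P.d i z)) = 0}
  obtain ⟨h₀, hh₀⟩ := lift 0 (x • LinearMap.id - a ∘ₗ π) (fun z => (hπ _).1 (by simp [ha]))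
  have step (i : ℕ) (s : S i) : ∃ t : S (i + 1),
      ∀ z, P.d (i + 1) (t.1 z) = x • z - s.1 (P.d i z) := by
    obtain ⟨h, hh⟩ := lift (i + 1) (x • LinearMap.id - s.1 ∘ₗ P.d i) (fun z => (hP i _).1 (s.2 z))
    refine ⟨⟨h, fun z => ?_⟩, hh⟩
    rw [map_sub, hh, map_smul]
    simp [P.d_d]
  choose next hnext using step
  let s (i : ℕ) : S i := Nat.rec ⟨h₀, fun z => by
    rw [map_sub, hh₀, map_smul]
    simp [hπ.apply_apply_eq_zero]⟩ (fun i t => next i t) i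
  refine ⟨⟨fun i => (s i).1, fun i _ z => ?_⟩⟩
  have := hnext i (s i) z
  change (s i).1 _ + P.d (i + 1) ((next i (s i)).1 z) = _
  rw [this, add_sub_cancel]

open FGModuleCat in
/-- A module is in the `(l.length + 1)`-ball around the modules of finite length if the elements of
`l` act stably trivially and generate an ideal with radical the maximal ideal. -/
theorem abBall_fl_of_list [IsLocalRing R] (M : FGModuleCat.{u} R) (l : List R)
    (hl : ∀ x ∈ l, x ∈ M.stableAnnihilator)
    (hr : IsLocalRing.maximalIdeal R ≤ (Ideal.span {x | x ∈ l}).radical) :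
    abBall (fl R) (l.length + 1) M := by
  obtain ⟨P, π, hπs, hπ, hP⟩ := M.exists_resolution
  obtain ⟨Q, hQ, -, i, r, hir⟩ := ProjComplex.exists_iterated_cone l 0 l.length (by simp) P
    fun x hx => by
      obtain ⟨a, ha⟩ := hl x hx
      obtain ⟨b, hb⟩ := Module.projective_lifting_property π M.freeCoverMap hπs
      refine ProjComplex.nonempty_partialHomotopy hπ hP (b ∘ₗ a) fun z => ?_
      rw [← ha]
      exact LinearMap.congr_fun hb (a z)
  -- The elements with a power killing `z` form a radical ideal; containing `l`, it contains the
  -- maximal ideal.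
  have key {N : Type u} [AddCommGroup N] [Module R N] [Module.Finite R N]
      (h : ∀ x ∈ l, ∀ z : N, ∃ k : ℕ, x ^ k • z = 0) : IsFiniteLength R N := by
    refine isFiniteLength_of_forall_exists_pow_smul_eq_zero fun y hy z => ?_
    have hle : Ideal.span {x | x ∈ l} ≤ (Ideal.torsionOf R N z).radical := by
      rw [Ideal.span_le]
      intro x hx
      obtain ⟨k, hk⟩ := h x hx z
      exact ⟨k, hk⟩
    obtain ⟨k, hk⟩ := Ideal.radical_le_radical_iff.2 hle (hr hy)
    exact ⟨k, hk⟩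
  have := ProjComplex.abBall_coker (C := fl R) Q (key fun x hx z => by
      obtain ⟨z, rfl⟩ := Submodule.Quotient.mk_surjective _ z
      obtain ⟨k, w, hw⟩ := (hQ x hx).zero z
      exact ⟨k, (Submodule.Quotient.mk_eq_zero _).2 ⟨w, hw.symm⟩⟩)
    (fun i => key fun x hx z => by
      obtain ⟨z, hz⟩ := z
      obtain ⟨z, rfl⟩ := Submodule.Quotient.mk_surjective _ z
      obtain ⟨k, w, hw⟩ := (hQ x hx).succ i z hz
      exact ⟨k, Subtype.ext ((Submodule.Quotient.mk_eq_zero _).2 ⟨w, hw.symm⟩)⟩) l.length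
  refine abBall_of_abBracket_abBall_imp (M := Q.coker l.length) (fun C h => ?_) this
  let e : P.coker 0 ≃ₗ[R] M := (Submodule.quotEquivOfEq _ _ hπ.linearMap_ker_eq.symm).trans
    (LinearMap.quotKerEquivOfSurjective π hπs)
  exact abBracket_of_linearRetract (i ∘ₗ e.symm.toLinearMap) (e.toLinearMap ∘ₗ r) (by simp [hir]) h

theorem abBracket_le_abBall {P : ObjectProperty (FGModuleCat.{u} R)} {M : FGModuleCat.{u} R} (n : ℕ)
    (h : ∀ P : ObjectProperty (FGModuleCat.{u} R), abBracket P M) : abBall P (n + 1) M := by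
  cases n with
  | zero => exact h _
  | succ n => exact h _

/-- A splitting of the localized free cover becomes a global map after clearing a denominator `t`.
It satisfies the required identity after multiplication by a further `c`, and `c * t` lies outside
`p`. -/
theorem not_stableAnnihilator_le {M : FGModuleCat.{u} R} {p : PrimeSpectrum R}
    (h : Module.Projective (Localization.AtPrime p.asIdeal)
      (LocalizedModule p.asIdeal.primeCompl M)) :
    ¬ M.stableAnnihilator ≤ p.asIdeal := by
  let S := p.asIdeal.primeCompl
  let F := M.freeCover
  let π := LocalizedModule.map S M.freeCoverMap
  have hπ : Function.Surjective π := LocalizedModule.map_surjective S _ M.freeCoverMap_surjective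
  obtain ⟨s, hs⟩ := Module.projective_lifting_property (R := Localization S) π LinearMap.id hπ
  have : Module.FinitePresentation R M := Module.finitePresentation_of_finite R M
  obtain ⟨a, t, hat⟩ := Module.FinitePresentation.exists_lift_of_isLocalizedModule S
    (LocalizedModule.mkLinearMap S F)
    (s.restrictScalars R ∘ₗ LocalizedModule.mkLinearMap S M)
  have h₁ : LocalizedModule.mkLinearMap S M ∘ₗ (M.freeCoverMap ∘ₗ a) =
      LocalizedModule.mkLinearMap S M ∘ₗ (t.1 • LinearMap.id) := by
    ext z
    have h₂ := congrArg π (LinearMap.congr_fun hat z)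
    have h₃ : π (s (LocalizedModule.mkLinearMap S M z)) = LocalizedModule.mkLinearMap S M z :=
      LinearMap.congr_fun hs _
    have h₄ : π (t.1 • s (LocalizedModule.mkLinearMap S M z)) =
        t.1 • LocalizedModule.mkLinearMap S M z := by
      conv_rhs => rw [← h₃]
      exact (π.restrictScalars R).map_smul t.1 _
    have h₅ : π (LocalizedModule.mkLinearMap S F (a z)) =
        LocalizedModule.mkLinearMap S M (M.freeCoverMap (a z)) :=
      IsLocalizedModule.map_apply S (LocalizedModule.mkLinearMap S F) _ M.freeCoverMap (a z)
    change LocalizedModule.mkLinearMap S M (M.freeCoverMap (a z)) =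
      LocalizedModule.mkLinearMap S M (t.1 • z)
    rw [map_smul, ← h₄, ← h₅]
    exact h₂
  obtain ⟨c, hc⟩ := Module.Finite.exists_smul_of_comp_eq_of_isLocalizedModule S
    (LocalizedModule.mkLinearMap S M) _ _ h₁
  intro hle
  refine (c * t).2 (hle ⟨c.1 • a, fun z => ?_⟩)
  have := LinearMap.congr_fun hc z
  change M.freeCoverMap (c.1 • a z) = (c.1 * t.1) • z
  rw [map_smul, mul_smul]
  exact this

end Resolution

/-! ### Balls under exact functors that preserve projectives. -/

section ExactFunctor

universe v' u'

variable {A : Type u} [Category.{v} A] [Abelian A] {B : Type u'} [Category.{v'} B] [Abelian B]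
  (F : A ⥤ B) [F.Additive] [PreservesFiniteLimits F] [PreservesFiniteColimits F]

/-- For syzygies: an exact sequence ending in a projective splits, so the kernel is a summand of the
projective middle term. -/
theorem abBracket_le_projective_map (hF : ∀ X, Projective X → Projective (F.obj X))
    {P : ObjectProperty A} (hP : ∀ X, P X → Projective (F.obj X)) {X : A} (h : abBracket P X) :
    Projective (F.obj X) := by
  induction h with
  | of_mem X h => exact hP X h
  | of_projective X h => exact hF X h
  | biprod X Y _ _ _ _ =>
    have : PreservesBinaryBiproducts F := preservesBinaryBiproducts_of_preservesBinaryProducts F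
    exact Projective.of_iso (F.mapBiprod X Y).symm inferInstance
  | retract e _ h =>
    have := h
    exact (e.map F).projective
  | syzygy S hS hX₂ _ h =>
    have : Projective (S.map F).X₃ := h
    have : Projective (S.map F).X₂ := hF _ hX₂
    let s := (hS.map_of_exact F).splittingOfProjective
    exact Retract.projective (Y := (S.map F).X₂) ⟨_, s.r, s.f_r⟩

theorem abExtension_projective_map {P Q : ObjectProperty A} (hP : ∀ X, P X → Projective (F.obj X))
    (hQ : ∀ X, Q X → Projective (F.obj X)) {X : A} (h : abExtension P Q X) :
    Projective (F.obj X) := by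
  obtain ⟨Y, Z, f, g, w, hS, hY, hZ⟩ := h
  have := hP Y hY
  have : Projective ((ShortComplex.mk f g w).map F).X₁ := this
  have := hQ Z hZ
  have : Projective ((ShortComplex.mk f g w).map F).X₃ := this
  let s := (hS.map_of_exact F).splittingOfProjective
  exact Projective.of_iso s.isoBinaryBiproduct.symm inferInstance

theorem abBall_projective_map (hF : ∀ X, Projective X → Projective (F.obj X))
    {P : ObjectProperty A} (hP : ∀ X, P X → Projective (F.obj X)) {n : ℕ} {X : A}
    (h : abBall P (n + 1) X) : Projective (F.obj X) := by
  induction n generalizing X with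
  | zero => exact abBracket_le_projective_map F hF hP h
  | succ n ih =>
    refine abBracket_le_projective_map F hF (fun Y hY => ?_) h
    exact abExtension_projective_map F (fun Z hZ => abBracket_le_projective_map F hF
      (fun _ h => ih h) hZ) (fun Z hZ => abBracket_le_projective_map F hF hP hZ) hY

end ExactFunctor

/-! ### Localization at primes and the equality for modules. -/

section Localization

variable {R : Type u} [CommRing R] [IsNoetherianRing R] (p : PrimeSpectrum R)

/-- The two models of the localization of a module agree. -/
noncomputable def modLocEquiv (M : FGModuleCat.{u} R) :
    (modLoc p).obj M ≃ₗ[Localization.AtPrime p.asIdeal]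
      LocalizedModule p.asIdeal.primeCompl M :=
  Shrink.linearEquiv.{u} (Localization.AtPrime p.asIdeal) (LocalizedModule p.asIdeal.primeCompl M)

theorem projective_modLoc_iff (M : FGModuleCat.{u} R) : Projective ((modLoc p).obj M) ↔
    Module.Free (Localization.AtPrime p.asIdeal) (LocalizedModule p.asIdeal.primeCompl M) := by
  rw [projective_iff_moduleProjective]
  have : Module.Finite (Localization.AtPrime p.asIdeal) (LocalizedModule p.asIdeal.primeCompl M) :=
    Module.Finite.equiv (modLocEquiv p M)
  constructor
  · intro h
    have := Module.Projective.of_equiv (modLocEquiv p M)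
    exact Module.free_of_flat_of_isLocalRing
  · intro h
    exact Module.Projective.of_equiv (modLocEquiv p M).symm

theorem projective_modLoc_of_projective (M : FGModuleCat.{u} R) (h : Projective M) :
    Projective ((modLoc p).obj M) := by
  have := moduleProjective_of_projective M
  exact projective_of_moduleProjective _ (Module.projective_of_isLocalizedModule (M := M.obj)
    (Rₛ := Localization p.asIdeal.primeCompl)
    (Mₛ := M.obj.localizedModule p.asIdeal.primeCompl) p.asIdeal.primeCompl
    (M.obj.localizedModuleMkLinearMap p.asIdeal.primeCompl))

theorem isZero_modLoc_of_isFiniteLength [IsLocalRing R] {M : FGModuleCat.{u} R} (h : fl R M)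
    {p : PrimeSpectrum R} (hp : p ≠ IsLocalRing.closedPoint R) : IsZero ((modLoc p).obj M) := by
  have := subsingleton_localizedModule_of_isFiniteLength (N := M) h hp
  have := (modLocEquiv p M).toEquiv.subsingleton
  rw [IsZero.iff_id_eq_zero]
  exact FGModuleCat.hom_ext (LinearMap.ext fun x => Subsingleton.elim _ _)

theorem abBall_fl_iff [IsLocalRing R] {d : ℕ} (hd : ringKrullDim R = d) (M : FGModuleCat.{u} R) :
    abBall (fl R) (d + 1) M ↔ modPhi R {IsLocalRing.closedPoint R} M := by
  constructor
  · intro h p hp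
    rw [← projective_modLoc_iff]
    exact abBall_projective_map (modLoc p) (projective_modLoc_of_projective p) (fun X hX =>
      (isZero_modLoc_of_isFiniteLength hX hp).projective) h
  · intro h
    -- Parameters can be chosen only in a proper ideal; in the other case `M` is projective.
    by_cases htop : M.stableAnnihilator = ⊤
    · have := FGModuleCat.projective_of_stableAnnihilator_eq_top htop
      exact abBracket_le_abBall d fun _ => .of_projective _ (projective_of_moduleProjective M this)
    · obtain ⟨l, rfl, hl, hr⟩ := exists_list_maximalIdeal_le_radical hd htop fun p hp =>
        not_stableAnnihilator_le (by
          have := h p hp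
          infer_instance)
      exact abBall_fl_of_list M l hl hr

end Localization

/-! ### Triangulated balls and their comparison with abelian balls. -/

section Balls

universe v' u'

variable {T : Type u'} [Category.{v'} T] [HasZeroObject T] [HasShift T ℤ] [Preadditive T]
  [∀ n : ℤ, (shiftFunctor T n).Additive] [Pretriangulated T]

theorem triBracket_of_iso {P : ObjectProperty T} {X Y : T} (e : X ≅ Y) (h : triBracket P Y) :
    triBracket P X :=
  .retract (Retract.ofIso e) h

theorem triBracket_triBracket {P : ObjectProperty T} {X : T} (h : triBracket (triBracket P) X) :
    triBracket P X := by
  induction h with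
  | of_mem X h => exact h
  | zero X h => exact .zero X h
  | biprod X Y _ _ h h' => exact .biprod X Y h h'
  | retract e _ h => exact .retract e h
  | shift X n _ h => exact .shift X n h

theorem triBall_of_triBracket_triBall {P : ObjectProperty T} {n : ℕ} {X : T}
    (h : triBracket (triBall P (n + 1)) X) : triBall P (n + 1) X := by
  cases n with
  | zero => exact triBracket_triBracket h
  | succ n => exact triBracket_triBracket h

/-- A full subcategory closed under extensions, shifts, direct summands and containing the zero
objects contains every ball around each of its subcategories. -/
theorem triBall_le {P Q : ObjectProperty T} (hPQ : P ≤ Q) (hzero : ∀ X, IsZero X → Q X)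
    (hext : ObjectProperty.extensionProduct Q Q ≤ Q)
    (hretract : ∀ {X Y : T}, Retract X Y → Q Y → Q X)
    (hshift : ∀ (X : T) (n : ℤ), Q X → Q (X⟦n⟧)) (n : ℕ) : triBall P (n + 1) ≤ Q := by
  have bracket {P' : ObjectProperty T} (h : P' ≤ Q) : triBracket P' ≤ Q := by
    intro X hX
    induction hX with
    | of_mem X hX => exact h X hX
    | zero X hX => exact hzero X hX
    | biprod X Y _ _ hX hY =>
      exact hext _ ⟨X, Y, _, _, _, binaryBiproductTriangle_distinguished X Y, hX, hY⟩
    | retract e _ hX => exact hretract e hX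
    | shift X n _ hX => exact hshift X n hX
  induction n with
  | zero => exact bracket hPQ
  | succ n ih =>
    refine bracket fun X hX => hext X ?_
    exact ObjectProperty.monotone_extensionProduct_left _ (bracket ih) _
      (ObjectProperty.monotone_extensionProduct_right _ (bracket hPQ) _ hX)

variable {A : Type u} [Category.{v} A] [Abelian A] (F : A ⥤ T) [F.Additive]

/-- Once projectives become zero, the connecting map identifies a syzygy with a shift by `-1`, so
the triangulated bracket absorbs syzygies. -/
theorem abBracket_le_triBracket (hproj : ∀ X, Projective X → IsZero (F.obj X))
    (htri : ∀ S : ShortComplex A, S.ShortExact →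
      ∃ h, Triangle.mk (F.map S.f) (F.map S.g) h ∈ distTriang T)
    {P : ObjectProperty A} {Q : ObjectProperty T} (hP : ∀ X, P X → Q (F.obj X)) {X : A}
    (h : abBracket P X) : triBracket Q (F.obj X) := by
  induction h with
  | of_mem X h => exact .of_mem _ (hP X h)
  | of_projective X h => exact .zero _ (hproj X h)
  | biprod X Y _ _ h h' =>
    have := preservesBinaryBiproducts_of_preservesBiproducts F
    exact triBracket_of_iso (F.mapBiprod X Y) (.biprod _ _ h h')
  | retract e _ h => exact .retract (e.map F) h
  | syzygy S hS hX₂ _ h =>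
    obtain ⟨δ, hδ⟩ := htri S hS
    have hiso : IsIso δ := (Triangle.isZero₂_iff_isIso₃ _ hδ).1 (hproj _ hX₂)
    let e : (F.obj S.X₃)⟦(-1 : ℤ)⟧ ≅ F.obj S.X₁ :=
      (shiftFunctor T (-1 : ℤ)).mapIso (asIso δ) ≪≫ (shiftEquiv T (1 : ℤ)).unitIso.symm.app _
    exact triBracket_of_iso e.symm (.shift _ _ h)

theorem abBall_le_triBall (hproj : ∀ X, Projective X → IsZero (F.obj X))
    (htri : ∀ S : ShortComplex A, S.ShortExact →
      ∃ h, Triangle.mk (F.map S.f) (F.map S.g) h ∈ distTriang T)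
    {P : ObjectProperty A} {Q : ObjectProperty T} (hP : ∀ X, P X → Q (F.obj X)) {n : ℕ} {X : A}
    (h : abBall P (n + 1) X) : triBall Q (n + 1) (F.obj X) := by
  induction n generalizing X with
  | zero => exact abBracket_le_triBracket F hproj htri hP h
  | succ n ih =>
    refine abBracket_le_triBracket F hproj htri (fun M hM => ?_) h
    obtain ⟨Y, Z, f, g, w, hS, hY, hZ⟩ := hM
    obtain ⟨δ, hδ⟩ := htri _ hS
    exact ⟨F.obj Y, F.obj Z, F.map f, F.map g, δ, hδ,
      abBracket_le_triBracket F hproj htri (fun _ h => ih h) hY,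
      abBracket_le_triBracket F hproj htri hP hZ⟩

end Balls

/-! ### Modules in the singularity category, and thickness of local vanishing. -/

section Functors

open scoped ZeroObject

variable (R : Type u) [CommRing R] [IsNoetherianRing R]

instance modToDb_additive : (modToDb R).Additive where
  map_add {X Y f g} := by
    apply ObjectProperty.hom_ext
    exact (DerivedCategory.singleFunctor (FGModuleCat.{u} R) 0).map_add

instance modToDsg_additive : (modToDsg R).Additive :=
  inferInstanceAs (modToDb R ⋙ Dsg.quot R).Additive

theorem exists_modToDb_distinguished (S : ShortComplex (FGModuleCat.{u} R)) (hS : S.ShortExact) :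
    ∃ h, Triangle.mk ((modToDb R).map S.f) ((modToDb R).map S.g) h ∈ distTriang (Db R) := by
  let ι : Db R ⥤ DerivedCategory (FGModuleCat.{u} R) := DerivedCategory.Bounded.ι
  let δ : ι.obj ((modToDb R).obj S.X₃) ⟶ (ι.obj ((modToDb R).obj S.X₁))⟦(1 : ℤ)⟧ := hS.singleδ
  obtain ⟨ε, hε⟩ :
      ∃ ε, ι.map ε = δ ≫ (ι.commShiftIso (1 : ℤ)).inv.app ((modToDb R).obj S.X₁) :=
    ι.map_surjective _
  refine ⟨ε, isomorphic_distinguished _ hS.singleTriangle_distinguished _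
    (Triangle.isoMk _ _ (Iso.refl _) (Iso.refl _) (Iso.refl _) ?_ ?_ ?_)⟩
  · exact (Category.comp_id _).trans (Category.id_comp _).symm
  · exact (Category.comp_id _).trans (Category.id_comp _).symm
  · have h : (ι.map ε ≫ (ι.commShiftIso (1 : ℤ)).hom.app _) ≫
        (shiftFunctor _ (1 : ℤ)).map (𝟙 (ι.obj ((modToDb R).obj S.X₁))) = 𝟙 _ ≫ δ := by
      rw [hε, Category.assoc, Category.assoc, Iso.inv_hom_id_app_assoc, CategoryTheory.Functor.map_id,
        Category.id_comp]
      exact Category.comp_id δ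
    exact h

theorem exists_modToDsg_distinguished (S : ShortComplex (FGModuleCat.{u} R)) (hS : S.ShortExact) :
    ∃ h, Triangle.mk ((modToDsg R).map S.f) ((modToDsg R).map S.g) h ∈ distTriang (Dsg R) := by
  obtain ⟨h, hh⟩ := exists_modToDb_distinguished R S hS
  exact ⟨_, (Dsg.quot R).map_distinguished _ hh⟩

theorem isZero_quot_obj_of_perfect {X : Db R} (hX : perfect R X) : IsZero ((Dsg.quot R).obj X) := by
  have : IsIso ((Dsg.quot R).map (0 : X ⟶ 0)) := by
    refine MorphismProperty.Q_inverts _ _ (((perfect R).trW_iff' _).2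
      ⟨X, 𝟙 X, 0, contractible_distinguished X, hX⟩)
  exact ((Dsg.quot R).map_isZero (isZero_zero (Db R))).of_iso
    (asIso ((Dsg.quot R).map (0 : X ⟶ 0)))

theorem isZero_modToDsg_obj_of_projective (M : FGModuleCat.{u} R) (hM : Projective M) :
    IsZero ((modToDsg R).obj M) := by
  refine isZero_quot_obj_of_perfect R ⟨(CochainComplex.singleFunctor _ 0).obj M, 0, 0,
    ?_, ?_, fun i => ?_, ⟨(DerivedCategory.singleFunctorIsoCompQ _ 0).app M⟩⟩
  · exact inferInstanceAs (CochainComplex.IsStrictlyGE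
      ((HomologicalComplex.single (FGModuleCat R) (ComplexShape.up ℤ) 0).obj M) 0)
  · exact inferInstanceAs (CochainComplex.IsStrictlyLE
      ((HomologicalComplex.single (FGModuleCat R) (ComplexShape.up ℤ) 0).obj M) 0)
  · rw [← projective_iff_moduleProjective]
    by_cases hi : i = 0
    · subst hi
      exact Projective.of_iso
        (HomologicalComplex.singleObjXSelf (ComplexShape.up ℤ) 0 M).symm hM
    · exact (HomologicalComplex.isZero_single_obj_X (ComplexShape.up ℤ) 0 M i hi).projective

theorem triBall_modToDsg_of_abBall {P : ObjectProperty (FGModuleCat.{u} R)} {n : ℕ}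
    {M : FGModuleCat.{u} R} (h : abBall P (n + 1) M) :
    triBall (P.map (modToDsg R)) (n + 1) ((modToDsg R).obj M) :=
  abBall_le_triBall _ (isZero_modToDsg_obj_of_projective R) (exists_modToDsg_distinguished R)
    (fun _ hX => ObjectProperty.prop_map_obj _ _ hX) h

variable {R}

/-- Localization commutes with the embedding of modules in the bounded derived category. -/
noncomputable def dbLocModToDbIso (p : PrimeSpectrum R) (M : FGModuleCat.{u} R) :
    (dbLoc p).obj ((modToDb R).obj M) ≅ (modToDb _).obj ((modLoc p).obj M) :=
  DerivedCategory.Bounded.ι.preimageIso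
    (((modLoc p).mapDerivedCategorySingleFunctor 0).app M)

/-- Localization commutes with the quotient functors. -/
noncomputable def dsgLocQuotIso (p : PrimeSpectrum R) :
    Dsg.quot R ⋙ dsgLoc p ≅ dbLoc p ⋙ Dsg.quot _ :=
  Localization.fac _ _ _

theorem isZero_dsgLoc_quot_iff (p : PrimeSpectrum R) (X : Db R) :
    IsZero ((dsgLoc p).obj ((Dsg.quot R).obj X)) ↔ IsZero ((Dsg.quot _).obj ((dbLoc p).obj X)) :=
  ((dsgLocQuotIso p).app X).isZero_iff

theorem isZero_dsgLoc_modToDsg_iff (p : PrimeSpectrum R) (M : FGModuleCat.{u} R) :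
    IsZero ((dsgLoc p).obj ((modToDsg R).obj M)) ↔
      IsZero ((modToDsg _).obj ((modLoc p).obj M)) :=
  (isZero_dsgLoc_quot_iff p _).trans ((Dsg.quot _).mapIso (dbLocModToDbIso p M)).isZero_iff

theorem dsgPhi_of_iso {Φ : Set (PrimeSpectrum R)} {X Y : Dsg R} (e : X ≅ Y)
    (h : dsgPhi R Φ Y) : dsgPhi R Φ X :=
  fun p hp => (h p hp).of_iso ((dsgLoc p).mapIso e)

/-- The check is made on a representative in `Db R`, where `dbLoc p` commutes with shifts;
`dsgLocQuotIso` transports the result. -/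
theorem dsgPhi_shift {Φ : Set (PrimeSpectrum R)} (X : Dsg R) (n : ℤ)
    (h : dsgPhi R Φ X) : dsgPhi R Φ (X⟦n⟧) := by
  let Y := (Dsg.quot R).objPreimage X
  let e : (Dsg.quot R).obj Y ≅ X := (Dsg.quot R).objObjPreimageIso X
  refine dsgPhi_of_iso ((shiftFunctor _ n).mapIso e.symm ≪≫
    ((Dsg.quot R).commShiftIso n).symm.app Y) fun p hp => ?_
  have h₁ := (isZero_dsgLoc_quot_iff p Y).1 (dsgPhi_of_iso e h p hp)
  refine (isZero_dsgLoc_quot_iff p _).2 ?_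
  exact ((shiftFunctor _ n).map_isZero h₁).of_iso
    ((Dsg.quot _).mapIso (((dbLoc p).commShiftIso n).app Y) ≪≫
      ((Dsg.quot _).commShiftIso n).app ((dbLoc p).obj Y))

theorem dsgPhi_extension {Φ : Set (PrimeSpectrum R)} :
    ObjectProperty.extensionProduct (dsgPhi R Φ) (dsgPhi R Φ) ≤ dsgPhi R Φ := by
  rintro X ⟨Y, Z, f, g, h, hT, hY, hZ⟩
  have := Localization.essSurj_mapArrow (Dsg.quot R) (perfect R).trW
  -- Every distinguished triangle of the quotient comes, up to isomorphism, from one in `Db R`,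
  -- which `dbLoc p` preserves.
  obtain ⟨T, e, hT'⟩ := ((Dsg.quot R).distTriang_iff _).1 hT
  have e₁ : Y ≅ (Dsg.quot R).obj T.obj₁ := Triangle.π₁.mapIso e
  have e₂ : X ≅ (Dsg.quot R).obj T.obj₂ := Triangle.π₂.mapIso e
  have e₃ : Z ≅ (Dsg.quot R).obj T.obj₃ := Triangle.π₃.mapIso e
  refine dsgPhi_of_iso e₂ fun p hp => (isZero_dsgLoc_quot_iff p _).2 ?_
  exact Triangle.isZero₂_of_isZero₁₃ _
    ((Dsg.quot _).map_distinguished _ ((dbLoc p).map_distinguished _ hT'))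
    ((isZero_dsgLoc_quot_iff p _).1 (dsgPhi_of_iso e₁.symm hY p hp))
    ((isZero_dsgLoc_quot_iff p _).1 (dsgPhi_of_iso e₃.symm hZ p hp))

theorem dsgPhi_retract {Φ : Set (PrimeSpectrum R)} {X Y : Dsg R} (e : Retract X Y)
    (h : dsgPhi R Φ Y) : dsgPhi R Φ X := fun p hp => by
  have e' := e.map (dsgLoc p)
  rw [IsZero.iff_id_eq_zero, ← e'.retract, (h p hp).eq_zero_of_src e'.r, comp_zero]

theorem dsgPhi_isZero {Φ : Set (PrimeSpectrum R)} {X : Dsg R} (h : IsZero X) : dsgPhi R Φ X :=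
  fun p _ => by
    have h₁ : IsZero ((dsgLoc p).obj ((Dsg.quot R).obj 0)) :=
      (isZero_dsgLoc_quot_iff p _).2
        ((Dsg.quot _).map_isZero ((dbLoc p).map_isZero (isZero_zero _)))
    exact h₁.of_iso ((dsgLoc p).mapIso (h.iso ((Dsg.quot R).map_isZero (isZero_zero _))))

theorem triBall_flDsg_le [IsLocalRing R] (n : ℕ) :
    triBall (flDsg R) (n + 1) ≤ dsgPhi R {IsLocalRing.closedPoint R} := by
  refine triBall_le ?_ (fun X hX => dsgPhi_isZero hX) dsgPhi_extension dsgPhi_retract dsgPhi_shift n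
  rintro X ⟨M, hM, ⟨e⟩⟩
  refine dsgPhi_of_iso e.symm fun p hp => (isZero_dsgLoc_modToDsg_iff p M).2 ?_
  exact (modToDsg _).map_isZero (isZero_modLoc_of_isFiniteLength hM hp)

end Functors

/-! ### Objects of the singularity category are shifts of modules. -/

section Reduction

open CochainComplex

section

variable {A : Type u} [Category.{v} A] [Abelian A]

/-- If `φ : F[-b] ⟶ K` is an epimorphism in the top degree `b` of `K`, then the cohomology of its
mapping cone vanishes in degrees `≥ b`. -/
theorem isLE_mappingCone_of_epi {F : A} {b b' : ℤ} (hb : b' + 1 = b) {K : CochainComplex A ℤ}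
    [K.IsStrictlyLE b] (φ : (HomologicalComplex.single A (ComplexShape.up ℤ) b).obj F ⟶ K)
    [Epi (φ.f b)] : (mappingCone φ).IsLE b' := by
  have hzero (i : ℤ) (hi : b < i) : IsZero ((mappingCone φ).X i) := by
    rw [mappingCone.isZero_X_iff]
    exact ⟨HomologicalComplex.isZero_single_obj_X _ _ _ _ (by lia),
      K.isZero_of_isStrictlyLE b i hi⟩
  have hepi : Epi ((mappingCone φ).d b' b) := by
    refine ⟨fun f g hfg => mappingCone.ext_from φ (b + 1) b rfl ?_ ?_⟩
    · exact (HomologicalComplex.isZero_single_obj_X _ _ _ _ (by lia)).eq_of_src _ _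
    · have h := mappingCone.inl_v_d φ b b' (b + 1) (by lia) (by lia)
      rw [HomologicalComplex.single_obj_d, zero_comp, sub_zero] at h
      rw [← cancel_epi (φ.f b), ← Category.assoc, ← Category.assoc, ← h, Category.assoc,
        Category.assoc, hfg]
  rw [CochainComplex.isLE_iff]
  intro i hi
  obtain rfl | hi : i = b ∨ b < i := by lia
  · rw [HomologicalComplex.exactAt_iff' _ b' i (i + 1) (by simp; lia) (by simp)]
    rw [ShortComplex.exact_iff_epi _ ((hzero (i + 1) (by lia)).eq_of_tgt _ _)]
    exact hepi
  · exact ShortComplex.exact_of_isZero_X₂ _ (hzero i hi)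

end

variable (R : Type u) [CommRing R] [IsNoetherianRing R]

theorem perfectObj_single (F : FGModuleCat.{u} R) (hF : Module.Projective R F) (n : ℤ) :
    perfectObj R (DerivedCategory.Q.obj ((HomologicalComplex.single _ (.up ℤ) n).obj F)) := by
  refine ⟨(HomologicalComplex.single _ (.up ℤ) n).obj F, n, n,
    ?_, ?_, fun i => ?_, ⟨Iso.refl _⟩⟩
  · exact inferInstance
  · exact inferInstance
  · rw [← projective_iff_moduleProjective]
    by_cases hi : i = n
    · subst hi
      exact Projective.of_iso (HomologicalComplex.singleObjXSelf (ComplexShape.up ℤ) i F).symm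
        (projective_of_moduleProjective F hF)
    · exact (HomologicalComplex.isZero_single_obj_X (ComplexShape.up ℤ) n F i hi).projective

variable {R} in
/-- Up to an isomorphism in the singularity category, the highest cohomology of a bounded complex
can be killed. -/
theorem exists_quot_iso_of_isLE (X : Db R) {a b b' : ℤ} (hb : b' + 1 = b) (hab : a ≤ b')
    (ha : X.obj.IsGE a) (hb : X.obj.IsLE b) :
    ∃ Y : Db R, Y.obj.IsGE a ∧ Y.obj.IsLE b' ∧
      Nonempty ((Dsg.quot R).obj X ≅ (Dsg.quot R).obj Y) := by
  obtain ⟨K, _, _, ⟨e⟩⟩ := X.obj.exists_iso_Q_obj_of_isGE_of_isLE a b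
  obtain ⟨F, π, _, hπ⟩ := exists_free_cover (K.X b)
  have hF : Module.Projective R F := inferInstance
  let φ : (HomologicalComplex.single _ (.up ℤ) b).obj F ⟶ K :=
    HomologicalComplex.mkHomFromSingle (FGModuleCat.ofHom π) fun k hk =>
      (K.isZero_of_isStrictlyLE b k (by simp at hk; lia)).eq_of_tgt _ _
  have : Epi (FGModuleCat.ofHom π) :=
    (forget₂ (FGModuleCat R) (ModuleCat R)).epi_of_epi_map ((ModuleCat.epi_iff_surjective _).2 hπ)
  have : Epi (φ.f b) := by
    rw [HomologicalComplex.mkHomFromSingle_f]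
    exact epi_comp _ _
  have hLE : (mappingCone φ).IsLE b' := isLE_mappingCone_of_epi (by lia) φ
  -- In the cone `F` sits in degree `b'`, so `a ≤ b'` keeps the lower bound.
  have hGE : (mappingCone φ).IsStrictlyGE a := by
    rw [isStrictlyGE_iff]
    intro i hi
    rw [mappingCone.isZero_X_iff]
    exact ⟨HomologicalComplex.isZero_single_obj_X _ _ _ _ (by lia),
      K.isZero_of_isStrictlyGE a i hi⟩
  let Y : Db R := ⟨DerivedCategory.Q.obj (mappingCone φ), ⟨a, inferInstance⟩, ⟨b', inferInstance⟩⟩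
  let ι : Db R ⥤ DerivedCategory (FGModuleCat.{u} R) := DerivedCategory.Bounded.ι
  obtain ⟨s, hs⟩ : ∃ s : X ⟶ Y, ι.map s = e.hom ≫ DerivedCategory.Q.map (mappingCone.inr φ) :=
    ι.map_surjective _
  -- The triangle starts with the perfect complex `F[-b]`, so the map from `K` to the cone is
  -- inverted in the quotient.
  have hinr : (perfectObj R).trW (DerivedCategory.Q.map (mappingCone.inr φ)) :=
    ((perfectObj R).trW_iff_of_distinguished' _
      (DerivedCategory.mappingCone_triangle_distinguished φ)).2 (perfectObj_single R F hF b)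
  have hs' : (perfect R).trW s := by
    refine (ObjectProperty.inverseImage_trW_iff (perfectObj R) ι s).2 ?_
    rw [hs]
    exact MorphismProperty.RespectsIso.precomp _ _ _ hinr
  have := Localization.inverts (Dsg.quot R) (perfect R).trW s hs'
  exact ⟨Y, (inferInstance : (DerivedCategory.Q.obj (mappingCone φ)).IsGE a),
    (inferInstance : (DerivedCategory.Q.obj (mappingCone φ)).IsLE b'), ⟨asIso ((Dsg.quot R).map s)⟩⟩

variable {R} in
/-- Each bounded complex becomes isomorphic to a shift of a module in the singularity category. -/
theorem exists_quot_iso_shift_modToDsg (X : Db R) :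
    ∃ (M : FGModuleCat.{u} R) (k : ℤ),
      Nonempty ((Dsg.quot R).obj X ≅ ((modToDsg R).obj M)⟦k⟧) := by
  obtain ⟨⟨a, ha⟩, ⟨b, hb⟩⟩ := X.property
  have main (n : ℕ) (X : Db R) (ha : X.obj.IsGE a) (hb : X.obj.IsLE (a + n)) :
      ∃ (M : FGModuleCat.{u} R) (k : ℤ),
        Nonempty ((Dsg.quot R).obj X ≅ ((modToDsg R).obj M)⟦k⟧) := by
    induction n generalizing X with
    | zero =>
      have : X.obj.IsLE a := by simpa using hb
      obtain ⟨M, ⟨e⟩⟩ := X.obj.exists_iso_singleFunctor_obj_of_isGE_of_isLE a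
      let ι : Db R ⥤ DerivedCategory (FGModuleCat.{u} R) := DerivedCategory.Bounded.ι
      let e' : ι.obj X ≅ ι.obj (((modToDb R).obj M)⟦-a⟧) :=
        e ≪≫ (((DerivedCategory.singleFunctors _).shiftIso (-a) a 0 (by lia)).app M).symm ≪≫
          ((ι.commShiftIso (-a)).app ((modToDb R).obj M)).symm
      exact ⟨M, -a, ⟨(Dsg.quot R).mapIso (ι.preimageIso e') ≪≫
        ((Dsg.quot R).commShiftIso (-a)).app ((modToDb R).obj M)⟩⟩
    | succ n ih =>
      obtain ⟨Y, hYa, hYb, ⟨e⟩⟩ := exists_quot_iso_of_isLE (b' := a + n) X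
        (by push_cast; ring) (by lia) ha hb
      obtain ⟨M, k, ⟨e'⟩⟩ := ih Y hYa hYb
      exact ⟨M, k, ⟨e ≪≫ e'⟩⟩
  have ha' : X.obj.IsGE a := ha
  have hb' : X.obj.IsLE b := hb
  refine main (b - a).toNat X ha' ?_
  exact DerivedCategory.TStructure.t.isLE_of_le X.obj b _ (by lia)

end Reduction

/-! ### From local vanishing to a locally free syzygy, and the main theorem. -/

section FiniteProjectiveDimension

universe w

/-- A bounded complex of projective objects has no nonzero morphisms in the derived category to
objects placed in a low degree. -/
theorem eq_zero_of_projective_of_lt {A : Type u} [Category.{v} A] [Abelian A]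
    [HasDerivedCategory.{w} A] {K : CochainComplex A ℤ} {a b n : ℤ} [K.IsStrictlyGE a]
    [K.IsStrictlyLE b] [∀ i, Projective (K.X i)] (hn : -n < a) {Y : A}
    (f : DerivedCategory.Q.obj K ⟶ ((DerivedCategory.singleFunctor A 0).obj Y)⟦n⟧) : f = 0 := by
  let L : CochainComplex A ℤ := (HomologicalComplex.single A (ComplexShape.up ℤ) (-n)).obj Y
  let e : DerivedCategory.Q.obj L ≅ ((DerivedCategory.singleFunctor A 0).obj Y)⟦n⟧ :=
    (DerivedCategory.singleFunctorIsoCompQ A (-n)).symm.app Y ≪≫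
      (((DerivedCategory.singleFunctors A).shiftIso n (-n) 0 (by lia)).app Y).symm
  have hK : K.IsKProjective := K.isKProjective_of_projective b
  obtain ⟨g, hg⟩ := (CochainComplex.IsKProjective.Qh_map_bijective K
    ((HomotopyCategory.quotient _ _).obj L)).surjective
      ((DerivedCategory.quotientCompQhIso _).hom.app K ≫ f ≫ e.inv ≫
        (DerivedCategory.quotientCompQhIso _).inv.app L)
  obtain ⟨g, rfl⟩ := (HomotopyCategory.quotient _ _).map_surjective g
  -- By K-projectivity `f` comes from a chain map, whose target lives only in degree `-n`, below the
  -- support of `K`.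
  have hg₀ : g = 0 := by
    refine HomologicalComplex.hom_ext _ _ fun i => ?_
    by_cases hi : i = -n
    · exact (K.isZero_of_isStrictlyGE a i (by lia)).eq_of_src _ _
    · exact (HomologicalComplex.isZero_single_obj_X _ _ _ _ hi).eq_of_tgt _ _
  rw [hg₀, Functor.map_zero, Functor.map_zero, ← Category.assoc, ← Category.assoc] at hg
  have h₁ := zero_of_comp_mono _ hg.symm
  rw [Category.assoc] at h₁
  have h₂ := zero_of_epi_comp _ h₁
  exact zero_of_comp_mono _ h₂

variable {R : Type u} [CommRing R] [IsNoetherianRing R]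

/-- An object which vanishes in the singularity category is a direct summand of a perfect
complex. -/
theorem exists_retract_perfect_of_isZero {X : Db R} (h : IsZero ((Dsg.quot R).obj X)) :
    ∃ P : Db R, perfect R P ∧ Nonempty (Retract X P) := by
  obtain ⟨Z, s, hs, h₀⟩ := (MorphismProperty.map_eq_iff_postcomp (Dsg.quot R) (perfect R).trW
    (𝟙 X) 0).1 (h.eq_of_src _ _)
  rw [Category.id_comp, zero_comp] at h₀
  subst h₀
  -- The zero map out of `X` now has perfect fibre `P`, and the identity of `X` lifts along `P ⟶ X`.
  obtain ⟨P, r, _, hT, hP⟩ := ((perfect R).trW_iff' _).1 hs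
  obtain ⟨i, hi⟩ := Triangle.coyoneda_exact₂ _ hT (𝟙 X) comp_zero
  exact ⟨P, hP, ⟨⟨i, r, hi.symm⟩⟩⟩

open Abelian in
/-- A module which vanishes in the singularity category has finite projective dimension. -/
theorem exists_hasProjectiveDimensionLT_of_isZero {N : FGModuleCat.{u} R}
    (h : IsZero ((modToDsg R).obj N)) : ∃ n, HasProjectiveDimensionLT N n := by
  obtain ⟨P, ⟨K, a, b, _, _, hK, ⟨e⟩⟩, ⟨ρ⟩⟩ := exists_retract_perfect_of_isZero h
  have (i : ℤ) : Projective (K.X i) := projective_of_moduleProjective _ (hK i)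
  have : HasExt.{u + 1} (FGModuleCat.{u} R) := hasExt_of_hasDerivedCategory _
  -- For `i ≥ 1 - a` the degree `-i` lies below `a`, so every class in `Ext` of degree `i` vanishes
  -- on the retract.
  refine ⟨(1 - a).toNat, (hasProjectiveDimensionLT_iff _ _).2 fun i hi Y x => ?_⟩
  let ρ' : Retract ((DerivedCategory.singleFunctor (FGModuleCat.{u} R) 0).obj N)
      (DerivedCategory.Bounded.ι.obj P) := ρ.map DerivedCategory.Bounded.ι
  have h₀ (f : (DerivedCategory.singleFunctor (FGModuleCat.{u} R) 0).obj N ⟶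
      ((DerivedCategory.singleFunctor (FGModuleCat.{u} R) 0).obj Y)⟦(i : ℤ)⟧) : f = 0 := by
    have h₁ : e.inv ≫ ρ'.r ≫ f = 0 := eq_zero_of_projective_of_lt (a := a) (b := b) (by lia) _
    rw [← Category.id_comp f, ← ρ'.retract, Category.assoc, zero_of_epi_comp _ h₁, comp_zero]
  exact Ext.homEquiv.injective ((h₀ _).trans (h₀ _).symm)

/-- The short exact sequence of a module, a free module and the first syzygy. -/
noncomputable abbrev FGModuleCat.syzShortComplex (M : FGModuleCat.{u} R) (n : ℕ) :
    ShortComplex (FGModuleCat.{u} R) :=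
  ShortComplex.mk (X₁ := M.syz (n + 1)) (X₂ := (M.syz n).freeCover) (X₃ := M.syz n)
    (FGModuleCat.ofHom (M.syzInclusion n)) (FGModuleCat.ofHom (M.syz n).freeCoverMap)
    (by ext x; exact (M.syzInclusion_exact n).apply_apply_eq_zero x)

theorem FGModuleCat.syzShortComplex_shortExact (M : FGModuleCat.{u} R) (n : ℕ) :
    (M.syzShortComplex n).ShortExact :=
  (fgModule_shortExact_iff _).2
    ⟨M.syzInclusion_injective n, M.syzInclusion_exact n, (M.syz n).freeCoverMap_surjective⟩

theorem FGModuleCat.projective_freeCover (M : FGModuleCat.{u} R) : Projective M.freeCover :=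
  projective_of_moduleProjective _ inferInstance

theorem projective_modLoc_syz (p : PrimeSpectrum R) (M : FGModuleCat.{u} R) (n : ℕ)
    (h : HasProjectiveDimensionLT ((modLoc p).obj M) (n + 1)) :
    Projective ((modLoc p).obj (M.syz n)) := by
  have main (k : ℕ) : ∀ i, HasProjectiveDimensionLT ((modLoc p).obj (M.syz i)) (k + 1) →
      Projective ((modLoc p).obj (M.syz (i + k))) := by
    induction k with
    | zero => exact fun i h => projective_iff_hasProjectiveDimensionLT_one.2 h
    | succ k ih =>
      intro i h
      have hS := (M.syzShortComplex_shortExact i).map_of_exact (modLoc p)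
      have h' := ih (i + 1) ((hS.hasProjectiveDimensionLT_X₃_iff k
        (projective_modLoc_of_projective p _ (M.syz i).projective_freeCover)).1 h)
      rwa [add_right_comm] at h'
  have h' := main n 0 h
  rwa [zero_add] at h'

theorem mem_freeLocus_syz_succ (p : PrimeSpectrum R) {M : FGModuleCat.{u} R} {n : ℕ}
    (h : p ∈ Module.freeLocus R (M.syz n)) : p ∈ Module.freeLocus R (M.syz (n + 1)) := by
  rw [Module.mem_freeLocus, ← projective_modLoc_iff] at h ⊢
  have hS := (M.syzShortComplex_shortExact n).map_of_exact (modLoc p)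
  have h₃ : HasProjectiveDimensionLT ((modLoc p).obj (M.syz n)) 1 := inferInstance
  exact projective_iff_hasProjectiveDimensionLT_one.2
    ((hS.hasProjectiveDimensionLT_X₃_iff 0
      (projective_modLoc_of_projective p _ (M.syz n).projective_freeCover)).1
      (hasProjectiveDimensionLT_of_ge ((modLoc p).obj (M.syz n)) 1 2 (by lia)))

/-- If `M` vanishes in the singularity category of `R_p` for all `p` outside `Φ`, then some syzygy
of `M` is locally free outside `Φ`. -/
theorem exists_modPhi_syz {Φ : Set (PrimeSpectrum R)} {M : FGModuleCat.{u} R}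
    (h : dsgPhi R Φ ((modToDsg R).obj M)) : ∃ n, modPhi R Φ (M.syz n) := by
  -- In a noetherian space every subset is quasi-compact. The free loci of the syzygies are open and
  -- increasing, so one of them contains the whole complement of `Φ`.
  have hcompact : IsCompact Φᶜ := TopologicalSpace.NoetherianSpace.isCompact _
  have hcover : Φᶜ ⊆ ⋃ n, Module.freeLocus R (M.syz n) := fun p hp => by
    obtain ⟨n, hn⟩ := exists_hasProjectiveDimensionLT_of_isZero
      ((isZero_dsgLoc_modToDsg_iff p M).1 (h p hp))
    refine Set.mem_iUnion.2 ⟨n, (projective_modLoc_iff p _).1 ?_⟩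
    exact projective_modLoc_syz p M n (hasProjectiveDimensionLT_of_ge _ n _ (by lia))
  obtain ⟨n, hn⟩ := hcompact.elim_directed_cover (fun n => Module.freeLocus R (M.syz n))
    (fun n =>
      have := Module.finitePresentation_of_finite R (M.syz n)
      Module.isOpen_freeLocus) hcover
    (directed_of_isDirected_le (monotone_nat_of_le_succ fun n p hp => mem_freeLocus_syz_succ p hp))
  exact ⟨n, fun p hp => hn hp⟩

theorem triBall_of_triBall_syz {P : ObjectProperty (Dsg R)} {r : ℕ} {M : FGModuleCat.{u} R} {n : ℕ}
    (h : triBall P (r + 1) ((modToDsg R).obj (M.syz n))) :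
    triBall P (r + 1) ((modToDsg R).obj M) := by
  induction n with
  | zero => exact h
  | succ n ih =>
    obtain ⟨δ, hδ⟩ := exists_modToDsg_distinguished R _ (M.syzShortComplex_shortExact n)
    have : IsIso δ := (Triangle.isZero₂_iff_isIso₃ _ hδ).1
      (isZero_modToDsg_obj_of_projective R _ (M.syz n).projective_freeCover)
    exact ih (triBall_of_triBracket_triBall
      (triBracket_of_iso (asIso δ) (.shift _ 1 (.of_mem _ h))))

theorem dsgPhi_le_triBall [IsLocalRing R] {d : ℕ} (hd : ringKrullDim R = d) :
    dsgPhi R {IsLocalRing.closedPoint R} ≤ triBall (flDsg R) (d + 1) := by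
  intro X hX
  let Y := (Dsg.quot R).objPreimage X
  let e : (Dsg.quot R).obj Y ≅ X := (Dsg.quot R).objObjPreimageIso X
  obtain ⟨M, k, ⟨e'⟩⟩ := exists_quot_iso_shift_modToDsg Y
  let e₁ : X ≅ ((modToDsg R).obj M)⟦k⟧ := e.symm ≪≫ e'
  let e₂ : (modToDsg R).obj M ≅ X⟦-k⟧ :=
    (shiftEquiv (Dsg R) k).unitIso.app _ ≪≫ (shiftFunctor (Dsg R) (-k)).mapIso e₁.symm
  obtain ⟨n, hn⟩ := exists_modPhi_syz (dsgPhi_of_iso e₂ (dsgPhi_shift X (-k) hX))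
  have h := triBall_of_triBall_syz (triBall_modToDsg_of_abBall R ((abBall_fl_iff hd _).2 hn))
  exact triBall_of_triBracket_triBall (triBracket_of_iso e₁ (.shift _ k (.of_mem _ h)))

end FiniteProjectiveDimension

theorem theorem4p6 (R : Type u) [CommRing R] [IsNoetherianRing R] [IsLocalRing R]
    (d : ℕ) (hd : ringKrullDim R = d) :
    modPhi R {IsLocalRing.closedPoint R} = abBall (fl R) (d + 1) ∧
      dsgPhi R {IsLocalRing.closedPoint R} = triBall (flDsg R) (d + 1) :=
  ⟨funext fun M => propext (abBall_fl_iff hd M).symm,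
    le_antisymm (dsgPhi_le_triBall hd) (triBall_flDsg_le d)⟩
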